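/- Let $t$ be an even positive integer, and let $\beta, q, x, b$ be complex numbers with $b\neq 0$, $|q|<1$ and $|x^2q^{2t}|<1$. Write $(a;q)_\infty=\prod_{j\ge 0}(1-aq^j)$. Let $\mathcal{SC}$ be the set of self-conjugate integer partitions (including the empty partition). For a partition $\lambda$ let $|\lambda|$ be its size, $\mathcal H_t(\lambda)$ the multiset of those hook-lengths of the boxes of its Ferrers diagram that are divisible by $t$, with $|\mathcal H_t(\lambda)|$ its number of elements counted with multiplicity, and $\mathrm{BG}(\lambda)=\sum_{(i,j)\in\lambda}(-1)^{i+j}$ its BG-rank, the sum being over the boxes of the Ferrers diagram ($i$ the row, $j$ the column). Then both series below converge absolutely and $$\sum_{\lambda\in\mathcal{SC}}q^{|\lambda|}x^{|\mathcal H_t(\lambda)|}b^{\mathrm{BG}(\lambda)}\sum_{h\in\mathcal H_t(\lambda)}h^{\beta}=\frac{(q^{2t};q^{2t})_\infty^{t/2}}{(x^2q^{2t};x^2q^{2t})_\infty^{t/2}}\,(-bq;q^4)_\infty\,(-q^3/b;q^4)_\infty\sum_{k\ge 1}(tk)^{\beta+1}\frac{x^{2k}q^{2kt}}{1-x^{2k}q^{2kt}}.$$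 -/

import Mathlib

noncomputable section

/-- The infinite `q`-Pochhammer symbol `(a; q)_∞ = ∏_{j ≥ 0} (1 - a q ^ j)`. -/
def qPochhammerInf (a q : ℂ) : ℂ := ∏' j : ℕ, (1 - a * q ^ j)

/-- For `‖q‖ < 1` the product defining `(a; q)_∞` converges. -/
theorem hasProd_qPochhammerInf (a : ℂ) {q : ℂ} (hq : ‖q‖ < 1) :
    HasProd (fun j : ℕ => 1 - a * q ^ j) (qPochhammerInf a q) := by
  have h : Summable (fun j : ℕ => ‖-(a * q ^ j)‖) := by
    simpa [norm_neg, norm_mul, norm_pow] using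
      (summable_geometric_of_lt_one (norm_nonneg q) hq).mul_left ‖a‖
  have h2 : Multipliable (fun j : ℕ => 1 - a * q ^ j) := by
    simpa [sub_eq_add_neg] using multipliable_one_add_of_summable h
  exact h2.hasProd

namespace YoungDiagram

/-- The self-conjugate partitions (the empty partition included), as Ferrers diagrams. -/
def selfConjugate : Set YoungDiagram := {μ | μ.transpose = μ}

/-- The arm-length of a box `c = (i, j)` (row `i`, column `j`, counted from `0`): the number of
boxes in the same row strictly to the right of it. -/
def arm (μ : YoungDiagram) (c : ℕ × ℕ) : ℕ :=
  (μ.cells.filter fun u => u.1 = c.1 ∧ c.2 < u.2).card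

/-- The leg-length of a box: the number of boxes in the same column strictly below it. -/
def leg (μ : YoungDiagram) (c : ℕ × ℕ) : ℕ :=
  (μ.cells.filter fun u => u.2 = c.2 ∧ c.1 < u.1).card

/-- The hook-length of a box: the box itself, the boxes to its right and the boxes below it. -/
def hookLength (μ : YoungDiagram) (c : ℕ × ℕ) : ℕ := μ.arm c + μ.leg c + 1

/-- The multiset of all hook-lengths of the boxes. -/
def hooks (μ : YoungDiagram) : Multiset ℕ := μ.cells.val.map μ.hookLength

/-- The multiset of all hook-lengths divisible by `t`. -/
def hooksMod (t : ℕ) (μ : YoungDiagram) : Multiset ℕ := μ.hooks.filter fun h => t ∣ h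

/-- The BG-rank: the sum of alternating signs `±1` over the boxes, with `+1` in the top left
corner. -/
def bgRank (μ : YoungDiagram) : ℤ := ∑ c ∈ μ.cells, (-1) ^ (c.1 + c.2)

end YoungDiagram

end

noncomputable section

/-! ### Maya diagrams

A Maya diagram is a set of integers (its beads) which differs from the set of negative integers
by a finite set. It is encoded by that finite set. -/

/-! Write `t = 2 * s`. A self-conjugate partition is determined by the finite set `D` of its
diagonal arms, and its size and BG-rank are sums over `D` of `2 * d + 1` and `(-1) ^ d`. Its
boundary is a Maya diagram in which `n ↦ -1 - n` exchanges beads and gaps. Boxes are pairs (bead,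
gap below it), and the hook-length is the difference of the positions.

Cut this diagram into its `2 * s` residue classes. The symmetry exchanges class `r` with class `2 *
s - 1 - r`; as the modulus is even, no class is fixed, so the classes `r < s` carry `s` independent
Maya diagrams of arbitrary charge (`quotientEquiv`). Hooks of length divisible by `t` live inside
one class and occur twice, once in each mirror class (`sum_pairs_double`). Size and BG-rank depend
on a runner only through its charge and its number `inv` of inversions, because energy equals `2 *
inv + charge ^ 2` (`wsum_energy`). The weight of a partition is therefore a product over the runners
of `θ_r(charge) * y ^ inv` with `y = x ^ 2 * q ^ (4 * s)`.

For one runner, moving a bead down by `k` matches diagrams with a marked removable `k`-hook with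
diagrams with a marked place to add one, and lowers `inv` by `k`; each diagram has exactly `k` more
addable places than removable hooks. If `W`, `R`, `A` are the weighted totals, then `R = y ^ k * A`
and `A - R = k * W`, so `R = k * y ^ k / (1 - y ^ k) * W` (`tsum_hookCount_weight`). Summing over
`k` gives the Lambert series.

Without hook sums, the total is the product of the series `∑ θ_r` times the `s`-th power of the
charge-zero generating function, which is `1 / (y; y)_∞`. The factor `∏ ∑ θ_r` is found by setting
`x = 1`, where the total is the expansion over `D` of the two remaining Pochhammer products; no
triple product identity enters. -/

theorem HasSum.of_eq {α M : Type*} [AddCommMonoid M] [TopologicalSpace M] {f g : α → M} {a b : M}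
    (h : HasSum f a) (h1 : ∀ n, g n = f n) (h2 : b = a) : HasSum g b := by
  rw [h2, funext h1]; exact h

namespace Maya

/-- `n` is a bead of the Maya diagram encoded by `X`. -/
def bead (X : Finset ℤ) (n : ℤ) : Prop := ¬ (n ∈ X ↔ n < 0)

/-- The sum of `g` over the nonnegative beads minus its sum over the negative gaps. -/
def wsum (g : ℤ → ℤ) (X : Finset ℤ) : ℤ := ∑ n ∈ X, if n < 0 then - g n else g n

/-- The charge of a Maya diagram. -/
def charge (X : Finset ℤ) : ℤ := wsum (fun _ => 1) X

/-- The Maya diagram with the position `n` switched. -/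
def toggle (X : Finset ℤ) (n : ℤ) : Finset ℤ := if n ∈ X then X.erase n else insert n X

open Classical in
/-- The indicator function of the beads. -/
def chi (X : Finset ℤ) (n : ℤ) : ℤ := if bead X n then 1 else 0

theorem bead_iff_mem {X : Finset ℤ} {n : ℤ} (hn : 0 ≤ n) : bead X n ↔ n ∈ X := by
  simp [bead, not_lt.mpr hn]

theorem bead_iff_notMem {X : Finset ℤ} {n : ℤ} (hn : n < 0) : bead X n ↔ n ∉ X := by
  simp [bead, hn]

theorem mem_iff_bead {X : Finset ℤ} {n : ℤ} : n ∈ X ↔ ¬ (bead X n ↔ n < 0) := by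
  simp only [bead]; tauto

theorem ext_bead {X Y : Finset ℤ} (h : ∀ n, bead X n ↔ bead Y n) : X = Y := by
  ext n; rw [mem_iff_bead, mem_iff_bead, h]

theorem mem_toggle {X : Finset ℤ} {n m : ℤ} :
    m ∈ toggle X n ↔ if m = n then n ∉ X else m ∈ X := by
  unfold toggle
  split_ifs with h1 h2 h2 <;> simp_all

theorem bead_toggle {X : Finset ℤ} {n m : ℤ} :
    bead (toggle X n) m ↔ if m = n then ¬ bead X n else bead X m := by
  simp only [bead, mem_toggle]
  split_ifs with h
  · subst h; tauto
  · rfl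

theorem bead_toggle_self {X : Finset ℤ} {n : ℤ} : bead (toggle X n) n ↔ ¬ bead X n := by
  simp [bead_toggle]

theorem bead_toggle_of_ne {X : Finset ℤ} {n m : ℤ} (h : m ≠ n) :
    bead (toggle X n) m ↔ bead X m := by
  simp [bead_toggle, h]

theorem toggle_toggle (X : Finset ℤ) (n : ℤ) : toggle (toggle X n) n = X := by
  apply ext_bead
  intro m
  simp only [bead_toggle]
  split_ifs with h
  · subst h; simp
  · rfl

theorem toggle_comm (X : Finset ℤ) (n m : ℤ) :
    toggle (toggle X n) m = toggle (toggle X m) n := by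
  apply ext_bead
  intro a
  simp only [bead_toggle]
  grind

theorem wsum_toggle_of_bead (g : ℤ → ℤ) {X : Finset ℤ} {n : ℤ} (h : bead X n) :
    wsum g (toggle X n) = wsum g X - g n := by
  unfold wsum toggle
  rcases lt_or_ge n 0 with hn | hn
  · rw [bead_iff_notMem hn] at h
    rw [if_neg h, Finset.sum_insert h, if_pos hn]; ring
  · rw [bead_iff_mem hn] at h
    rw [if_pos h, ← Finset.add_sum_erase _ _ h, if_neg (not_lt.mpr hn)]; ring

theorem wsum_toggle_of_not_bead (g : ℤ → ℤ) {X : Finset ℤ} {n : ℤ} (h : ¬ bead X n) :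
    wsum g (toggle X n) = wsum g X + g n := by
  have := wsum_toggle_of_bead g (bead_toggle_self.mpr h)
  rw [toggle_toggle] at this
  omega

theorem exists_bound (X : Finset ℤ) : ∃ N : ℤ, (∀ n, bead X n → n < N) ∧
    (∀ n, ¬ bead X n → -N ≤ n) := by
  obtain ⟨a, ha⟩ := X.bddAbove
  obtain ⟨b, hb⟩ := X.bddBelow
  refine ⟨|a| + |b| + 1, fun n h => ?_, fun n h => ?_⟩
  · rcases lt_or_ge n 0 with hn | hn
    · have := abs_nonneg a
      have := abs_nonneg b
      omega
    · have := ha (Finset.mem_coe.mpr ((bead_iff_mem hn).mp h))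
      have := le_abs_self a
      have := abs_nonneg b
      omega
  · rcases lt_or_ge n 0 with hn | hn
    · have := hb (Finset.mem_coe.mpr (not_not.mp (mt (bead_iff_notMem hn).mpr h)))
      have := neg_abs_le b
      have := abs_nonneg a
      omega
    · have := abs_nonneg a
      have := abs_nonneg b
      omega

/-! #### Counting beads -/

theorem hasSum_chi_sub (X : Finset ℤ) :
    HasSum (fun n => chi X n - chi ∅ n) (charge X) := by
  have h : (fun n => chi X n - chi ∅ n) =
      fun n => if n ∈ X then (if n < 0 then (-1 : ℤ) else 1) else 0 := by
    funext n
    simp only [chi, bead]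
    by_cases h1 : n ∈ X <;> by_cases h2 : n < 0 <;> simp [h1, h2]
  rw [h]
  have : HasSum (fun n => if n ∈ X then (if n < 0 then (-1 : ℤ) else 1) else 0)
      (∑ n ∈ X, if n ∈ X then (if n < 0 then (-1 : ℤ) else 1) else 0) :=
    hasSum_sum_of_ne_finset_zero (fun n hn => by simp [hn])
  refine this.of_eq (fun _ => rfl) ?_
  unfold charge wsum
  exact Finset.sum_congr rfl fun n hn => by simp [hn]

theorem chi_empty (n : ℤ) : chi ∅ n = if n < 0 then 1 else 0 := by
  simp [chi, bead]

theorem hasSum_chi_empty_shift (k : ℤ) :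
    HasSum (fun n => chi ∅ (n - k) - chi ∅ n) k := by
  have step : ∀ k : ℤ, HasSum (fun n => chi ∅ (n - (k + 1)) - chi ∅ (n - k)) 1 := by
    intro k
    convert hasSum_ite_eq k (1 : ℤ) using 2 with n
    rw [chi_empty, chi_empty]
    split_ifs <;> omega
  induction k using Int.induction_on with
  | zero => simp
  | succ k ih => exact ((step k).add ih).of_eq (fun n => by ring) (by ring)
  | pred k ih =>
    exact (ih.sub (step (-k - 1))).of_eq (fun n => by rw [sub_add_cancel]; ring) rfl

/-- The difference from the empty diagram has finite support, so shifting it does not change its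
sum; only the step function of the empty diagram contributes, by telescoping. -/
theorem hasSum_chi_shift (X : Finset ℤ) (k : ℤ) :
    HasSum (fun n => chi X (n - k) - chi X n) k := by
  have h1 := hasSum_chi_sub X
  have h2 := (Equiv.subRight k).hasSum_iff.mpr h1
  refine ((h2.sub h1).add (hasSum_chi_empty_shift k)).of_eq (fun n => ?_) (by ring)
  simp only [Function.comp, Equiv.subRight_apply]
  ring

theorem hasSum_gap_sub_bead (X : Finset ℤ) (n : ℤ) :
    HasSum (fun m => chi ∅ (m - n) - chi X m) (n - charge X) := by
  exact ((hasSum_chi_empty_shift n).sub (hasSum_chi_sub X)).of_eq (fun m => by ring) rfl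

/-! #### Inversions -/

theorem finite_pairs (X : Finset ℤ) :
    {p : ℤ × ℤ | bead X p.1 ∧ ¬ bead X p.2 ∧ p.2 < p.1}.Finite := by
  obtain ⟨N, h1, h2⟩ := exists_bound X
  refine ((Finset.Ico (-N) N) ×ˢ (Finset.Ico (-N) N)).finite_toSet.subset ?_
  rintro ⟨a, b⟩ ⟨ha, hb, hab⟩
  have := h1 _ ha
  have := h2 _ hb
  simp only [Finset.coe_product, Set.mem_prod, Finset.mem_coe, Finset.mem_Ico] at *
  omega

/-- The pairs consisting of a bead and a gap below it. -/
def pairs (X : Finset ℤ) : Finset (ℤ × ℤ) := (finite_pairs X).toFinset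

theorem mem_pairs {X : Finset ℤ} {p : ℤ × ℤ} :
    p ∈ pairs X ↔ bead X p.1 ∧ ¬ bead X p.2 ∧ p.2 < p.1 := by
  simp [pairs]

/-- The number of pairs consisting of a bead and a gap below it. -/
def inv (X : Finset ℤ) : ℕ := (pairs X).card

/-- The new bead gains a pair with each gap below `n` (`L`), and the lost gap loses a pair with each
bead above `n` (`U`). The difference of the two counts is the sum over `m` of `1_{m < n}` minus the
bead indicator. -/
theorem inv_toggle {X : Finset ℤ} {n : ℤ} (h : ¬ bead X n) :
    (inv (toggle X n) : ℤ) = inv X + n - charge X := by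
  classical
  set P := (pairs X).filter (fun p => p.1 ≠ n ∧ p.2 ≠ n) with hP
  set U := ((pairs X).filter (fun p => p.2 = n)).image Prod.fst with hU
  set L := ((pairs (toggle X n)).filter (fun p => p.1 = n)).image Prod.snd with hL
  have memU : ∀ m, m ∈ U ↔ bead X m ∧ n < m := by
    intro m
    simp only [hU, Finset.mem_image, Finset.mem_filter, mem_pairs, Prod.exists]
    constructor
    · rintro ⟨a, b, ⟨⟨h1, h2, h3⟩, rfl⟩, rfl⟩; exact ⟨h1, h3⟩
    · rintro ⟨h1, h2⟩; exact ⟨m, n, ⟨⟨h1, h, h2⟩, rfl⟩, rfl⟩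
  have memL : ∀ m, m ∈ L ↔ ¬ bead X m ∧ m < n := by
    intro m
    simp only [hL, Finset.mem_image, Finset.mem_filter, mem_pairs, Prod.exists]
    constructor
    · rintro ⟨a, b, ⟨⟨h1, h2, h3⟩, rfl⟩, rfl⟩
      exact ⟨by rwa [bead_toggle_of_ne h3.ne] at h2, h3⟩
    · rintro ⟨h1, h2⟩
      exact ⟨n, m, ⟨⟨bead_toggle_self.mpr h, by rwa [bead_toggle_of_ne h2.ne], h2⟩, rfl⟩, rfl⟩
  have c1 : inv X = P.card + U.card := by
    rw [hU, Finset.card_image_of_injOn, inv,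
      ← Finset.card_filter_add_card_filter_not (s := pairs X) (fun p => p.2 = n), add_comm]
    · congr 2
      ext p
      simp only [Finset.mem_filter, hP, mem_pairs]
      constructor
      · rintro ⟨h1, h2⟩; exact ⟨h1, fun e => h (e ▸ h1.1), h2⟩
      · rintro ⟨h1, -, h2⟩; exact ⟨h1, h2⟩
    · rintro ⟨a, b⟩ ha ⟨c, d⟩ hc e
      simp_all
  have c2 : inv (toggle X n) = P.card + L.card := by
    rw [hL, Finset.card_image_of_injOn, inv,
      ← Finset.card_filter_add_card_filter_not (s := pairs (toggle X n)) (fun p => p.1 = n),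
      add_comm]
    · congr 2
      ext p
      simp only [Finset.mem_filter, hP, mem_pairs]
      constructor
      · rintro ⟨⟨h1, h2, h3⟩, h4⟩
        have h5 : p.2 ≠ n := fun e => h2 (e.symm ▸ bead_toggle_self.mpr h)
        rw [bead_toggle_of_ne h4] at h1
        rw [bead_toggle_of_ne h5] at h2
        exact ⟨⟨h1, h2, h3⟩, h4, h5⟩
      · rintro ⟨⟨h1, h2, h3⟩, h4, h5⟩
        rw [bead_toggle_of_ne h4, bead_toggle_of_ne h5]
        exact ⟨⟨h1, h2, h3⟩, h4⟩
    · rintro ⟨a, b⟩ ha ⟨c, d⟩ hc e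
      simp_all
  have c3 : (L.card : ℤ) - U.card = n - charge X := by
    have hs : ∀ S : Finset ℤ, HasSum (fun m => if m ∈ S then (1 : ℤ) else 0) (S.card : ℤ) := by
      intro S
      have : HasSum (fun m => if m ∈ S then (1 : ℤ) else 0)
          (∑ m ∈ S, if m ∈ S then (1 : ℤ) else 0) :=
        hasSum_sum_of_ne_finset_zero (fun m hm => by simp [hm])
      simpa using this
    refine ((hs L).sub (hs U)).unique ((hasSum_gap_sub_bead X n).of_eq (fun m => ?_) rfl)
    rw [chi_empty]
    simp only [memU, memL, chi]
    by_cases hb : bead X m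
    · rcases lt_trichotomy m n with h1 | h1 | h1
      · simp [hb, h1, h1.not_gt]
      · exact absurd (h1 ▸ hb) h
      · simp [hb, h1, h1.not_gt]
    · rcases lt_or_ge m n with h1 | h1
      · simp [hb, h1]
      · simp [hb, h1.not_gt]
  rw [c1, c2]
  push_cast
  omega

/-- Filling a gap `n` at charge `c` adds `2 * n + 1` on the left; on the right it adds `2 * (n - c)`
from `inv_toggle` and `2 * c + 1` from the square. -/
theorem wsum_energy (X : Finset ℤ) :
    wsum (fun n => 2 * n + 1) X = 2 * inv X + charge X ^ 2 := by
  classical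
  induction X using Finset.induction_on with
  | empty =>
    have : pairs ∅ = ∅ := by
      ext p
      simp only [mem_pairs, bead, Finset.notMem_empty, iff_false]
      simp only [false_iff, not_not, not_and, not_lt]
      omega
    simp [wsum, charge, inv, this]
  | insert n X hn ih =>
    have ht : insert n X = toggle X n := by simp [toggle, hn]
    rw [ht]
    by_cases hb : bead X n
    · have h1 := inv_toggle (X := toggle X n) (n := n) (by rw [bead_toggle_self]; simpa)
      rw [toggle_toggle] at h1
      have h2 : charge (toggle X n) = charge X - 1 := wsum_toggle_of_bead _ hb
      rw [wsum_toggle_of_bead _ hb, ih]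
      rw [h2] at h1 ⊢
      rw [h1]; ring
    · have h1 := inv_toggle hb
      have h2 : charge (toggle X n) = charge X + 1 := wsum_toggle_of_not_bead _ hb
      rw [wsum_toggle_of_not_bead _ hb, ih, h1, h2]; ring

/-! #### Moving a bead -/

/-- The Maya diagram with the positions `a` and `a - k` switched. -/
def flip (k a : ℤ) (X : Finset ℤ) : Finset ℤ := toggle (toggle X a) (a - k)

theorem flip_flip (k a : ℤ) (X : Finset ℤ) : flip k a (flip k a X) = X := by
  unfold flip
  rw [toggle_comm _ (a - k) a, toggle_toggle, toggle_toggle]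

theorem bead_flip_left {k a : ℤ} (hk : k ≠ 0) {X : Finset ℤ} :
    bead (flip k a X) a ↔ ¬ bead X a := by
  rw [flip, bead_toggle_of_ne (by omega), bead_toggle_self]

theorem bead_flip_right {k a : ℤ} (hk : k ≠ 0) {X : Finset ℤ} :
    bead (flip k a X) (a - k) ↔ ¬ bead X (a - k) := by
  rw [flip, bead_toggle_self, bead_toggle_of_ne (by omega)]

theorem wsum_flip (g : ℤ → ℤ) {k a : ℤ} (hk : k ≠ 0) {X : Finset ℤ} (h1 : bead X a)
    (h2 : ¬ bead X (a - k)) : wsum g (flip k a X) = wsum g X - g a + g (a - k) := by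
  rw [flip, wsum_toggle_of_not_bead, wsum_toggle_of_bead _ h1]
  rwa [bead_toggle_of_ne (by omega)]

theorem charge_flip {k a : ℤ} (hk : k ≠ 0) {X : Finset ℤ} (h1 : bead X a)
    (h2 : ¬ bead X (a - k)) : charge (flip k a X) = charge X := by
  simp [charge, wsum_flip _ hk h1 h2]

theorem inv_flip {k a : ℤ} (hk : k ≠ 0) {X : Finset ℤ} (h1 : bead X a)
    (h2 : ¬ bead X (a - k)) : (inv X : ℤ) = inv (flip k a X) + k := by
  have e1 := wsum_energy X
  have e2 := wsum_energy (flip k a X)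
  rw [charge_flip hk h1 h2, wsum_flip _ hk h1 h2] at e2
  linarith

/-- Removing the hook lowers `inv` by its length, and `inv` stays nonnegative. -/
theorem sub_le_inv {X : Finset ℤ} {p : ℤ × ℤ} (hp : p ∈ pairs X) : p.1 - p.2 ≤ inv X := by
  obtain ⟨h1, h2, h3⟩ := mem_pairs.mp hp
  have := inv_flip (k := p.1 - p.2) (a := p.1) (by omega) h1 (by simpa using h2)
  omega

/-! #### Shifting -/

theorem finite_shift (c : ℤ) (X : Finset ℤ) : {n : ℤ | ¬ (bead X (n - c) ↔ n < 0)}.Finite := by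
  obtain ⟨N, h1, h2⟩ := exists_bound X
  refine (Finset.Icc (-|N| - |c|) (|N| + |c|)).finite_toSet.subset ?_
  intro n hn
  have := le_abs_self N
  have := neg_abs_le N
  have := le_abs_self c
  have := neg_abs_le c
  have h3 := h1 (n - c)
  have h4 := h2 (n - c)
  simp only [Set.mem_ofPred_eq, Finset.coe_Icc, Set.mem_Icc] at *
  by_cases hb : bead X (n - c)
  · have := h3 hb
    simp only [hb, true_iff, not_lt] at hn
    omega
  · have := h4 hb
    simp only [hb, false_iff, not_not] at hn
    omega

/-- The Maya diagram with all beads moved by `c`. -/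
def shift (c : ℤ) (X : Finset ℤ) : Finset ℤ := (finite_shift c X).toFinset

theorem bead_shift {c : ℤ} {X : Finset ℤ} {n : ℤ} : bead (shift c X) n ↔ bead X (n - c) := by
  rw [bead, shift, Set.Finite.mem_toFinset, Set.mem_ofPred_eq]
  by_cases h1 : bead X (n - c) <;> by_cases h2 : n < 0 <;> simp [h1, h2]

theorem shift_shift (c d : ℤ) (X : Finset ℤ) : shift c (shift d X) = shift (c + d) X := by
  apply ext_bead
  intro n
  rw [bead_shift, bead_shift, bead_shift, sub_sub]

theorem shift_zero (X : Finset ℤ) : shift 0 X = X := by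
  apply ext_bead
  intro n
  rw [bead_shift, sub_zero]

theorem charge_shift (c : ℤ) (X : Finset ℤ) : charge (shift c X) = charge X + c := by
  refine (hasSum_chi_sub (shift c X)).unique ?_
  refine ((hasSum_chi_sub X).add (hasSum_chi_shift X c)).of_eq (fun n => ?_) rfl
  have : chi (shift c X) n = chi X (n - c) := by
    by_cases h : bead X (n - c)
    · rw [chi, chi, if_pos h, if_pos (bead_shift.mpr h)]
    · rw [chi, chi, if_neg h, if_neg (mt bead_shift.mp h)]
  rw [this]; ring

theorem inv_shift (c : ℤ) (X : Finset ℤ) : inv (shift c X) = inv X := by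
  refine Finset.card_bij' (fun p _ => (p.1 - c, p.2 - c)) (fun p _ => (p.1 + c, p.2 + c)) ?_ ?_ ?_ ?_
  · rintro ⟨a, b⟩ h
    simp only [mem_pairs, bead_shift] at h ⊢
    exact ⟨h.1, h.2.1, by omega⟩
  · rintro ⟨a, b⟩ h
    simp only [mem_pairs, bead_shift, add_sub_cancel_right] at h ⊢
    exact ⟨h.1, h.2.1, by omega⟩
  · intro p _; simp
  · intro p _; simp

/-- A Maya diagram is determined by its charge and its shift to charge zero. -/
def chargeEquiv : ℤ × {X : Finset ℤ // charge X = 0} ≃ Finset ℤ where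
  toFun p := shift p.1 p.2
  invFun X := (charge X, ⟨shift (-charge X) X, by rw [charge_shift]; ring⟩)
  left_inv := by
    rintro ⟨c, X, hX⟩
    simp only [charge_shift, hX, zero_add, shift_shift, neg_add_cancel, shift_zero]
  right_inv X := by simp [shift_shift, shift_zero]

end Maya

/-! ### Generating functions of Maya diagrams -/

namespace Maya

open Filter Topology

/-- At charge zero the energy is `2 * inv`, so `r ^ inv` is the product of `√r ^ |2 * n + 1|` over
`n ∈ X`. Such products are summable over finite sets because the factors are summable over `ℤ`. -/
theorem summable_pow_inv {r : ℝ} (h0 : 0 ≤ r) (h1 : r < 1) :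
    Summable (fun X : {X : Finset ℤ // charge X = 0} => r ^ inv X.1) := by
  set s := √r with hs
  have hs0 : 0 ≤ s := Real.sqrt_nonneg r
  have hs1 : s < 1 := by rw [hs, Real.sqrt_lt' one_pos]; simpa using h1
  have hZ : Summable (fun n : ℤ => s ^ (2 * n + 1).natAbs) := by
    have hg : Summable (fun n : ℕ => s ^ (2 * n + 1)) :=
      Summable.of_nonneg_of_le (fun n => by positivity)
        (fun n => pow_le_pow_of_le_one hs0 hs1.le (by omega : n ≤ 2 * n + 1))
        (summable_geometric_of_lt_one hs0 hs1)
    refine Summable.of_nat_of_neg_add_one (hg.congr fun n => ?_) (hg.congr fun n => ?_)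
    · rfl
    · congr 1
  have hF := summable_finsetProd_of_summable_nonneg (fun n => by positivity) hZ
  refine (hF.comp_injective Subtype.val_injective).congr fun X => ?_
  have hX : ∑ n ∈ X.1, (2 * n + 1).natAbs = 2 * inv X.1 := by
    zify
    have := wsum_energy X.1
    rw [X.2] at this
    rw [zero_pow two_ne_zero, add_zero] at this
    rw [← this, wsum]
    refine Finset.sum_congr rfl fun n _ => ?_
    split_ifs with h
    · rw [abs_of_neg (by omega)]
    · rw [abs_of_pos (by omega)]
  simp only [Function.comp]
  rw [Finset.prod_pow_eq_pow_sum, hX, pow_mul, hs, Real.sq_sqrt h0]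

theorem summable_poly_mul_pow_inv (m : ℕ) {r : ℝ} (h0 : 0 ≤ r) (h1 : r < 1) :
    Summable (fun X : {X : Finset ℤ // charge X = 0} => (inv X.1 : ℝ) ^ m * r ^ inv X.1) := by
  -- An intermediate ratio `s` absorbs the polynomial: `n ^ m * (r / s) ^ n` is bounded.
  obtain ⟨s, hrs, hs1⟩ := exists_between h1
  have hs0 : 0 < s := h0.trans_lt hrs
  have ht := tendsto_pow_const_mul_const_pow_of_lt_one m (r := r / s) (by positivity)
    ((div_lt_one hs0).mpr hrs)
  obtain ⟨C, hC⟩ := ht.bddAbove_range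
  refine Summable.of_nonneg_of_le (fun X => by positivity) (fun X => ?_)
    ((summable_pow_inv hs0.le hs1).mul_left C)
  have h2 : (inv X.1 : ℝ) ^ m * (r / s) ^ inv X.1 ≤ C := hC ⟨inv X.1, rfl⟩
  calc (inv X.1 : ℝ) ^ m * r ^ inv X.1
      = ((inv X.1 : ℝ) ^ m * (r / s) ^ inv X.1) * s ^ inv X.1 := by
        rw [div_pow]; field_simp
    _ ≤ C * s ^ inv X.1 := by gcongr

/-- The generating function of the Maya diagrams of charge zero. -/
def zeroChargeSum (y : ℂ) : ℂ := ∑' X : {X : Finset ℤ // charge X = 0}, y ^ inv X.1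

theorem summable_norm_charge_mul {θ : ℤ → ℂ} (hθ : Summable fun c => ‖θ c‖) {h : ℕ → ℂ}
    (hh : Summable fun X : {X : Finset ℤ // charge X = 0} => ‖h (inv X.1)‖) :
    Summable fun X => ‖θ (charge X) * h (inv X)‖ := by
  rw [← chargeEquiv.summable_iff]
  refine (hθ.mul_of_nonneg hh (fun _ => norm_nonneg _) (fun _ => norm_nonneg _)).congr ?_
  rintro ⟨c, X, hX⟩
  simp [chargeEquiv, charge_shift, inv_shift, hX]

theorem tsum_charge_mul {θ : ℤ → ℂ} (hθ : Summable fun c => ‖θ c‖) {h : ℕ → ℂ}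
    (hh : Summable fun X : {X : Finset ℤ // charge X = 0} => ‖h (inv X.1)‖) :
    ∑' X, θ (charge X) * h (inv X) =
      (∑' c, θ c) * ∑' X : {X : Finset ℤ // charge X = 0}, h (inv X.1) := by
  rw [← chargeEquiv.tsum_eq, tsum_mul_tsum_of_summable_norm hθ hh]
  refine tsum_congr ?_
  rintro ⟨c, X, hX⟩
  simp [chargeEquiv, charge_shift, inv_shift, hX]

/-! #### Euler's product for the charge zero generating function -/

/-- The Maya diagrams of charge `c` without negative gaps. -/
abbrev NoGap (c : ℕ) := {X : Finset ℤ // charge X = c ∧ ∀ n < 0, bead X n}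

/-- The generating function of the Maya diagrams of charge `c` without negative gaps. -/
def noGapSum (y : ℂ) (c : ℕ) : ℂ := ∑' X : NoGap c, y ^ inv X.1

/-- The embedding of Maya diagrams of charge `c` without negative gaps into the diagrams of charge
zero. -/
def NoGap.toZero {c : ℕ} (X : NoGap c) : {X : Finset ℤ // charge X = 0} :=
  ⟨shift (-c) X.1, by rw [charge_shift, X.2.1]; ring⟩

theorem NoGap.toZero_injective {c : ℕ} : Function.Injective (NoGap.toZero (c := c)) := by
  intro X Y h
  have h1 : shift c (shift (-c) X.1) = shift c (shift (-c) Y.1) :=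
    congrArg (shift c) (congrArg Subtype.val h)
  rw [shift_shift, shift_shift, add_neg_cancel, shift_zero, shift_zero] at h1
  exact Subtype.ext h1

theorem NoGap.range_toZero {c : ℕ} :
    Set.range (NoGap.toZero (c := c)) = {X | ∀ n < -(c : ℤ), bead X.1 n} := by
  ext X
  constructor
  · rintro ⟨Y, rfl⟩ n hn
    simp only [NoGap.toZero, bead_shift]
    exact Y.2.2 _ (by omega)
  · intro h
    refine ⟨⟨shift c X.1, by rw [charge_shift, X.2, zero_add], fun n hn => ?_⟩, ?_⟩
    · rw [bead_shift]; exact h _ (by omega)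
    · apply Subtype.ext
      simp [NoGap.toZero, shift_shift, shift_zero]

theorem noGapSum_eq (y : ℂ) (c : ℕ) : noGapSum y c =
    ∑' X : {X : Finset ℤ // charge X = 0},
      Set.indicator {X | ∀ n < -(c : ℤ), bead X.1 n} (fun X => y ^ inv X.1) X := by
  rw [← tsum_subtype, ← NoGap.range_toZero,
    ← (Equiv.ofInjective _ NoGap.toZero_injective).tsum_eq, noGapSum]
  refine tsum_congr fun X => ?_
  simp [NoGap.toZero, inv_shift]

theorem summable_noGap {y : ℂ} (hy : ‖y‖ < 1) (c : ℕ) :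
    Summable fun X : NoGap c => y ^ inv X.1 := by
  refine Summable.of_norm ?_
  refine ((summable_pow_inv (norm_nonneg y) hy).comp_injective
    (NoGap.toZero_injective (c := c))).congr fun X => ?_
  simp [NoGap.toZero, inv_shift]

/-- Each charge-zero diagram has no gap below `-c` once `c` is large, so the indicators in
`noGapSum_eq` converge pointwise to one; `summable_pow_inv` dominates. -/
theorem tendsto_noGapSum {y : ℂ} (hy : ‖y‖ < 1) :
    Tendsto (noGapSum y) atTop (𝓝 (zeroChargeSum y)) := by
  simp_rw [funext (noGapSum_eq y)]
  refine tendsto_tsum_of_dominated_convergence (summable_pow_inv (norm_nonneg y) hy) ?_ ?_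
  · intro X
    refine tendsto_const_nhds.congr' ?_
    obtain ⟨N, -, hN⟩ := exists_bound X.1
    filter_upwards [eventually_ge_atTop N.toNat] with c hc
    rw [Set.indicator_of_mem]
    intro n hn
    by_contra hb
    have := hN n hb
    omega
  · refine Eventually.of_forall fun c X => ?_
    refine (norm_indicator_le_norm_self _ _).trans ?_
    simp

theorem noGapSum_zero (y : ℂ) : noGapSum y 0 = 1 := by
  have key : ∀ X : NoGap 0, X.1 = ∅ := by
    rintro ⟨X, h1, h2⟩
    have h3 : ∀ n ∈ X, 0 ≤ n := fun n hn => by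
      by_contra h
      exact (bead_iff_notMem (not_le.mp h)).mp (h2 n (not_le.mp h)) hn
    have h4 : charge X = X.card := by
      rw [charge, wsum, Finset.sum_congr rfl fun n hn => if_neg (not_lt.mpr (h3 n hn))]
      simp
    rw [h4] at h1
    exact Finset.card_eq_zero.mp (by exact_mod_cast h1)
  have hE : charge ∅ = ((0 : ℕ) : ℤ) ∧ ∀ n < 0, bead ∅ n := by
    refine ⟨by simp [charge, wsum], fun n hn => ?_⟩
    rw [bead_iff_notMem hn]; simp
  have hinv : inv ∅ = 0 := by
    have := wsum_energy ∅
    simp [wsum, charge] at this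
    omega
  rw [noGapSum, tsum_eq_single (⟨∅, hE⟩ : NoGap 0) fun X hX => absurd (Subtype.ext (key X)) hX]
  simp [hinv]

/-- Moving all beads up by one without filling the position `0`. -/
def raise (X : Finset ℤ) : Finset ℤ := toggle (shift 1 X) 0

theorem bead_raise {X : Finset ℤ} {n : ℤ} :
    bead (raise X) n ↔ if n = 0 then ¬ bead X (-1) else bead X (n - 1) := by
  rw [raise, bead_toggle]
  split_ifs with h
  · rw [bead_shift]; simp
  · rw [bead_shift]

theorem charge_raise {X : Finset ℤ} (h : bead X (-1)) : charge (raise X) = charge X := by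
  have : bead (shift 1 X) 0 := by rw [bead_shift]; simpa using h
  rw [raise, charge, wsum_toggle_of_bead _ this, ← charge, charge_shift]; ring

theorem inv_raise {X : Finset ℤ} (h : bead X (-1)) : (inv (raise X) : ℤ) = inv X + charge X := by
  have h1 : ¬ bead (raise X) 0 := by rw [bead_raise]; simpa using h
  have h2 := inv_toggle h1
  rw [charge_raise h, raise, toggle_toggle, inv_shift] at h2
  rw [raise]
  omega

/-- A diagram without negative gaps, of positive charge, has a bead or a gap at `0`. -/
def noGapSplit (c : ℕ) : NoGap c ⊕ NoGap (c + 1) → NoGap (c + 1) :=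
  Sum.elim
    (fun X => ⟨shift 1 X.1, by rw [charge_shift, X.2.1]; push_cast; ring, fun n hn => by
      rw [bead_shift]; exact X.2.2 _ (by omega)⟩)
    (fun X => ⟨raise X.1, by rw [charge_raise (X.2.2 _ (by omega)), X.2.1], fun n hn => by
      rw [bead_raise, if_neg hn.ne]; exact X.2.2 _ (by omega)⟩)

theorem shift_injective (c : ℤ) : Function.Injective (shift c) := fun X Y h => by
  have := congrArg (shift (-c)) h
  rwa [shift_shift, shift_shift, neg_add_cancel, shift_zero, shift_zero] at this

theorem noGapSplit_bijective (c : ℕ) : Function.Bijective (noGapSplit c) := by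
  have hl : ∀ X : NoGap c, bead (noGapSplit c (Sum.inl X)).1 0 := fun X => by
    simp only [noGapSplit, Sum.elim_inl, bead_shift]
    exact X.2.2 _ (by omega)
  have hr : ∀ X : NoGap (c + 1), ¬ bead (noGapSplit c (Sum.inr X)).1 0 := fun X => by
    simp only [noGapSplit, Sum.elim_inr, bead_raise, if_true, not_not]
    exact X.2.2 _ (by omega)
  constructor
  · rintro (X | X) (Y | Y) h
    · exact congrArg Sum.inl (Subtype.ext (shift_injective 1 (congrArg Subtype.val h)))
    · exact absurd (h ▸ hl X) (hr Y)
    · exact absurd (h ▸ hl Y) (hr X)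
    · refine congrArg Sum.inr (Subtype.ext (shift_injective 1 ?_))
      have : toggle (toggle (shift 1 X.1) 0) 0 = toggle (toggle (shift 1 Y.1) 0) 0 :=
        congrArg (fun Z => toggle Z 0) (congrArg Subtype.val h)
      rwa [toggle_toggle, toggle_toggle] at this
  · rintro ⟨Z, hZ1, hZ2⟩
    by_cases h0 : bead Z 0
    · refine ⟨Sum.inl ⟨shift (-1) Z, ?_, fun n hn => ?_⟩, Subtype.ext ?_⟩
      · rw [charge_shift, hZ1]; push_cast; ring
      · rw [bead_shift]
        rcases eq_or_ne n (-1) with rfl | h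
        · simpa using h0
        · exact hZ2 _ (by omega)
      · simp [noGapSplit, shift_shift, shift_zero]
    · refine ⟨Sum.inr ⟨shift (-1) (toggle Z 0), ?_, fun n hn => ?_⟩, Subtype.ext ?_⟩
      · rw [charge_shift, charge, wsum_toggle_of_not_bead _ h0, ← charge, hZ1]; push_cast; ring
      · rw [bead_shift, bead_toggle]
        split_ifs with h
        · exact h0
        · exact hZ2 _ (by omega)
      · simp [noGapSplit, raise, shift_shift, shift_zero, toggle_toggle]

/-- Split by position `0`. A bead there can be dropped by shifting down, with `inv` unchanged; a gap
there forms an inversion with each of the `c + 1` nonnegative beads, and removing it gives the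
factor `y ^ (c + 1)`. -/
theorem noGapSum_succ {y : ℂ} (hy : ‖y‖ < 1) (c : ℕ) :
    noGapSum y (c + 1) = noGapSum y c + y ^ (c + 1) * noGapSum y (c + 1) := by
  have h1 : HasSum ((fun X : NoGap (c + 1) => y ^ inv X.1) ∘ noGapSplit c)
      (noGapSum y c + y ^ (c + 1) * noGapSum y (c + 1)) := by
    apply HasSum.sum
    · refine (summable_noGap hy c).hasSum.of_eq (fun X => ?_) rfl
      simp [noGapSplit, inv_shift]
    · refine ((summable_noGap hy (c + 1)).hasSum.mul_left (y ^ (c + 1))).of_eq (fun X => ?_) rfl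
      simp only [noGapSplit, Function.comp, Sum.elim_inr]
      have := inv_raise (X.2.2 (-1) (by omega))
      rw [X.2.1] at this
      rw [← pow_add]
      congr 1
      omega
  have h2 := (Equiv.ofBijective _ (noGapSplit_bijective c)).hasSum_iff.mp h1
  exact (summable_noGap hy (c + 1)).hasSum.unique h2

theorem noGapSum_mul {y : ℂ} (hy : ‖y‖ < 1) (c : ℕ) :
    noGapSum y c * ∏ j ∈ Finset.range c, (1 - y * y ^ j) = 1 := by
  induction c with
  | zero => simp [noGapSum_zero]
  | succ c ih =>
    rw [Finset.prod_range_succ]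
    have := noGapSum_succ hy c
    calc _ = (noGapSum y (c + 1) - y ^ (c + 1) * noGapSum y (c + 1)) *
          ∏ j ∈ Finset.range c, (1 - y * y ^ j) := by ring
      _ = noGapSum y c * ∏ j ∈ Finset.range c, (1 - y * y ^ j) := by
        rw [eq_sub_of_add_eq this.symm]
      _ = 1 := ih

theorem zeroChargeSum_mul {y : ℂ} (hy : ‖y‖ < 1) :
    zeroChargeSum y * qPochhammerInf y y = 1 := by
  have h := (tendsto_noGapSum hy).mul (hasProd_qPochhammerInf y hy).tendsto_prod_nat
  simp_rw [noGapSum_mul hy] at h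
  exact tendsto_nhds_unique h tendsto_const_nhds |>.symm ▸ rfl

/-! #### Sums over hooks -/

/-- The number of hooks of length `k`. -/
def hookCount (k : ℕ) (X : Finset ℤ) : ℕ := ((pairs X).filter fun p => p.1 - p.2 = (k : ℤ)).card

open Classical in
theorem hasSum_removable {M : Type*} [AddCommGroup M] [TopologicalSpace M]
    {k : ℕ} (hk : 0 < k) (X : Finset ℤ) (c : M) :
    HasSum (fun a : ℤ => if bead X a ∧ ¬ bead X (a - k) then c else 0) (hookCount k X • c) := by
  set S := ((pairs X).filter fun p => p.1 - p.2 = (k : ℤ)).image Prod.fst with hS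
  have hmem : ∀ a, a ∈ S ↔ bead X a ∧ ¬ bead X (a - k) := by
    intro a
    simp only [hS, Finset.mem_image, Finset.mem_filter, mem_pairs, Prod.exists]
    constructor
    · rintro ⟨a, b, ⟨⟨h1, h2, h3⟩, h4⟩, rfl⟩
      obtain rfl : b = a - k := by omega
      exact ⟨h1, h2⟩
    · rintro ⟨h1, h2⟩
      exact ⟨a, a - k, ⟨⟨h1, h2, by omega⟩, by simp⟩, rfl⟩
  have hcard : S.card = hookCount k X := by
    rw [hS, hookCount, Finset.card_image_of_injOn]
    rintro ⟨a, b⟩ h1 ⟨a', b'⟩ h2 h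
    simp only [Finset.coe_filter, Set.mem_ofPred_eq] at h1 h2 h
    simp only [Prod.mk.injEq]
    omega
  have : HasSum (fun a => if bead X a ∧ ¬ bead X (a - k) then c else 0)
      (∑ a ∈ S, if bead X a ∧ ¬ bead X (a - k) then c else 0) :=
    hasSum_sum_of_ne_finset_zero fun a ha => if_neg (mt (hmem a).mpr ha)
  refine this.of_eq (fun _ => rfl) ?_
  rw [Finset.sum_congr rfl fun a ha => if_pos ((hmem a).mp ha), Finset.sum_const, hcard]

-- At each position, the addable indicator minus the removable one is the shifted bead indicator
-- minus the bead indicator, which sums to `k`.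
open Classical in
theorem hasSum_addable {M : Type*} [AddCommGroup M] [TopologicalSpace M] [IsTopologicalAddGroup M]
    {k : ℕ} (hk : 0 < k) (X : Finset ℤ) (c : M) :
    HasSum (fun a : ℤ => if ¬ bead X a ∧ bead X (a - k) then c else 0)
      ((hookCount k X + k) • c) := by
  have h1 : HasSum (fun n => (chi X (n - k) - chi X n) • c) ((k : ℤ) • c) :=
    (hasSum_chi_shift X k).map ((smulAddHom ℤ M).flip c) continuous_of_discreteTopology
  refine ((hasSum_removable hk X c).add h1).of_eq (fun a => ?_) ?_
  · by_cases h1 : bead X a <;> by_cases h2 : bead X (a - k) <;> simp [chi, h1, h2]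
  · rw [add_smul, natCast_zsmul]

/-! ### Weighted sums of hook statistics over one runner -/

variable {θ : ℤ → ℂ} {y : ℂ}

/-- The weight of a Maya diagram. -/
def weight (θ : ℤ → ℂ) (y : ℂ) (X : Finset ℤ) : ℂ := θ (charge X) * y ^ inv X

theorem summable_weight_poly (hθ : Summable fun c => ‖θ c‖) (hy : ‖y‖ < 1) (m : ℕ) :
    Summable fun X => (inv X : ℝ) ^ m * ‖weight θ y X‖ := by
  refine (summable_norm_charge_mul hθ (h := fun n => (n : ℂ) ^ m * y ^ n) ?_).congr fun X => ?_
  · exact (summable_poly_mul_pow_inv m (norm_nonneg y) hy).congr fun X => by simp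
  · simp [weight]; ring

theorem summable_norm_weight (hθ : Summable fun c => ‖θ c‖) (hy : ‖y‖ < 1) :
    Summable fun X => ‖weight θ y X‖ := by
  simpa using summable_weight_poly hθ hy 0

theorem tsum_weight (hθ : Summable fun c => ‖θ c‖) (hy : ‖y‖ < 1) :
    ∑' X, weight θ y X = (∑' c, θ c) * zeroChargeSum y :=
  tsum_charge_mul hθ (h := fun n => y ^ n)
    ((summable_pow_inv (norm_nonneg y) hy).congr fun X => by simp)

theorem hookCount_le_inv (k : ℕ) (X : Finset ℤ) : hookCount k X ≤ inv X :=
  Finset.card_filter_le _ _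

theorem summable_hookCount_weight (hθ : Summable fun c => ‖θ c‖) (hy : ‖y‖ < 1) (k : ℕ) :
    Summable fun X => (hookCount k X : ℝ) * ‖weight θ y X‖ := by
  refine Summable.of_nonneg_of_le (fun X => by positivity) (fun X => ?_)
    (summable_weight_poly hθ hy 1)
  rw [pow_one]
  gcongr
  exact hookCount_le_inv k X

theorem tsum_hookCount_weight (hθ : Summable fun c => ‖θ c‖) (hy : ‖y‖ < 1) {k : ℕ}
    (hk : 0 < k) :
    ∑' X, hookCount k X * weight θ y X =
      k * (y ^ k / (1 - y ^ k)) * ∑' X, weight θ y X := by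
  classical
  -- `u` sums over diagrams with a marked removable `k`-hook, `v` over diagrams with a marked place
  -- to add one.
  set u : Finset ℤ × ℤ → ℂ := fun p =>
    if bead p.1 p.2 ∧ ¬ bead p.1 (p.2 - k) then weight θ y p.1 else 0 with hu
  set v : Finset ℤ × ℤ → ℂ := fun p =>
    if ¬ bead p.1 p.2 ∧ bead p.1 (p.2 - k) then weight θ y p.1 else 0 with hv
  have hk0 : (k : ℤ) ≠ 0 := by omega
  have su : Summable u := by
    refine Summable.of_norm ((summable_prod_of_nonneg fun p => norm_nonneg _).mpr ⟨fun X => ?_, ?_⟩)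
    · refine (hasSum_removable hk X ‖weight θ y X‖).summable.congr fun a => ?_
      simp only [hu]; split_ifs <;> simp
    · refine (summable_hookCount_weight hθ hy k).congr fun X => ?_
      rw [← nsmul_eq_mul, ← (hasSum_removable hk X ‖weight θ y X‖).tsum_eq]
      refine tsum_congr fun a => ?_
      simp only [hu]; split_ifs <;> simp
  have sv : Summable v := by
    refine Summable.of_norm ((summable_prod_of_nonneg fun p => norm_nonneg _).mpr ⟨fun X => ?_, ?_⟩)
    · refine (hasSum_addable hk X ‖weight θ y X‖).summable.congr fun a => ?_
      simp only [hv]; split_ifs <;> simp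
    · refine ((summable_hookCount_weight hθ hy k).add
        ((summable_norm_weight hθ hy).mul_left (k : ℝ))).congr fun X => ?_
      rw [← add_mul, ← Nat.cast_add, ← nsmul_eq_mul,
        ← (hasSum_addable hk X ‖weight θ y X‖).tsum_eq]
      refine tsum_congr fun a => ?_
      simp only [hv]; split_ifs <;> simp
  have tu : HasSum (fun X => hookCount k X * weight θ y X) (∑' p, u p) :=
    su.hasSum.prod_fiberwise fun X => by
      simpa [hu] using hasSum_removable hk X (weight θ y X)
  have tv : HasSum (fun X => ((hookCount k X + k : ℕ) : ℂ) * weight θ y X) (∑' p, v p) :=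
    sv.hasSum.prod_fiberwise fun X => by
      simpa [hv] using hasSum_addable hk X (weight θ y X)
  -- Flipping the marked positions is an involution exchanging the supports of `u` and `v`; it keeps
  -- the charge and changes `inv` by `k`.
  have hcancel : ∑' p, u p = y ^ k * ∑' p, v p := by
    have he : Function.Involutive (fun p : Finset ℤ × ℤ => (flip k p.2 p.1, p.2)) := fun p => by
      simp [flip_flip]
    rw [← he.toPerm.tsum_eq, ← tsum_mul_left]
    refine tsum_congr ?_
    rintro ⟨X, a⟩
    simp only [Function.Involutive.coe_toPerm, hu, hv, bead_flip_left hk0, bead_flip_right hk0,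
      not_not]
    split_ifs with h
    · have h1 : bead (flip k a X) a := (bead_flip_left hk0).mpr h.1
      have h2 : ¬ bead (flip k a X) (a - k) := fun h' => (bead_flip_right hk0).mp h' h.2
      have e1 := inv_flip hk0 h1 h2
      have e2 := charge_flip hk0 h1 h2
      rw [flip_flip] at e1 e2
      have e3 : inv (flip k a X) = inv X + k := by omega
      rw [weight, weight, e3, ← e2, pow_add]; ring
    · simp
  have hF : HasSum (fun X => (k : ℂ) * weight θ y X) (∑' p, v p - ∑' p, u p) :=
    (tv.sub tu).of_eq (fun X => by push_cast; ring) rfl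
  have hF' := hF.tsum_eq
  rw [tsum_mul_left, hcancel] at hF'
  have hne : (1 - y ^ k) ≠ 0 := by
    intro h
    have h1 : ‖y ^ k‖ = 1 := by rw [← sub_eq_zero.mp h]; simp
    rw [norm_pow] at h1
    exact (pow_lt_one₀ (norm_nonneg y) hy hk.ne').ne h1
  rw [tu.tsum_eq, hcancel]
  have : ∑' p, v p = k * (∑' X, weight θ y X) / (1 - y ^ k) := by
    rw [hF']; field_simp
  rw [this]; ring

/-- The sum of `g` over the hook lengths. -/
def hookSum (g : ℕ → ℂ) (X : Finset ℤ) : ℂ := ∑ p ∈ pairs X, g (p.1 - p.2).toNat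

theorem norm_hookSum_le {g : ℕ → ℂ} {C : ℝ} {N : ℕ} (hg : ∀ h, 0 < h → ‖g h‖ ≤ C * h ^ N)
    (X : Finset ℤ) : ∑ p ∈ pairs X, ‖g (p.1 - p.2).toNat‖ ≤ C * (inv X : ℝ) ^ (N + 1) := by
  -- The bound at `h = 1` reads `‖g 1‖ ≤ C`.
  have hC : 0 ≤ C := by simpa using (norm_nonneg _).trans (hg 1 one_pos)
  calc ∑ p ∈ pairs X, ‖g (p.1 - p.2).toNat‖ ≤ ∑ p ∈ pairs X, C * (inv X : ℝ) ^ N := by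
        refine Finset.sum_le_sum fun p hp => ?_
        have h1 := sub_le_inv hp
        have h2 := (mem_pairs.mp hp).2.2
        refine (hg _ (by omega)).trans ?_
        gcongr
        omega
    _ = C * (inv X : ℝ) ^ (N + 1) := by
        rw [Finset.sum_const, nsmul_eq_mul, pow_succ]
        change (inv X : ℝ) * _ = _
        ring

theorem hasSum_hookCount {M : Type*} [AddCommMonoid M] [TopologicalSpace M] [ContinuousAdd M]
    (g : ℕ → M) (X : Finset ℤ) :
    HasSum (fun k : ℕ+ => hookCount k X • g k) (∑ p ∈ pairs X, g (p.1 - p.2).toNat) := by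
  have h : ∀ p ∈ pairs X, HasSum (fun k : ℕ+ => if p.1 - p.2 = ((k : ℕ) : ℤ) then g k else 0)
      (g (p.1 - p.2).toNat) := by
    intro p hp
    have h2 := (mem_pairs.mp hp).2.2
    have h3 : 0 < (p.1 - p.2).toNat := by omega
    obtain ⟨m, hm⟩ : ∃ m : ℕ+, (m : ℕ) = (p.1 - p.2).toNat := ⟨Nat.toPNat _ h3, rfl⟩
    rw [← hm]
    refine (hasSum_ite_eq m (g m)).of_eq (fun k : ℕ+ => ?_) rfl
    have : (p.1 - p.2 = ((k : ℕ) : ℤ)) ↔ k = m := by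
      rw [← PNat.coe_inj, hm]; omega
    by_cases h4 : k = m
    · rw [if_pos (this.mpr h4), if_pos h4, h4]
    · rw [if_neg (mt this.mp h4), if_neg h4]
  refine (hasSum_sum h).of_eq (fun k => ?_) rfl
  rw [hookCount, ← Finset.sum_filter, Finset.sum_const]

theorem summable_weight_hookSum (hθ : Summable fun c => ‖θ c‖) (hy : ‖y‖ < 1)
    {g : ℕ → ℂ} {C : ℝ} {N : ℕ} (hg : ∀ h, 0 < h → ‖g h‖ ≤ C * h ^ N) :
    Summable fun X => ‖weight θ y X * hookSum g X‖ := by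
  refine Summable.of_nonneg_of_le (fun X => norm_nonneg _) (fun X => ?_)
    ((summable_weight_poly hθ hy (N + 1)).mul_left C)
  rw [norm_mul, mul_comm, ← mul_assoc]
  gcongr
  exact (norm_sum_le _ _).trans (norm_hookSum_le hg X)

/-- Group the hooks by length `k` and exchange the sums over `X` and `k`; absolute convergence holds
because a hook sum is at most polynomial in `inv`. -/
theorem hasSum_weight_hookSum (hθ : Summable fun c => ‖θ c‖) (hy : ‖y‖ < 1)
    {g : ℕ → ℂ} {C : ℝ} {N : ℕ} (hg : ∀ h, 0 < h → ‖g h‖ ≤ C * h ^ N) :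
    HasSum (fun X => weight θ y X * hookSum g X)
      ((∑' X, weight θ y X) * ∑' k : ℕ+, k * g k * (y ^ (k : ℕ) / (1 - y ^ (k : ℕ)))) := by
  set f : Finset ℤ × ℕ+ → ℂ := fun p => weight θ y p.1 * (hookCount p.2 p.1 * g p.2) with hf
  have hs : Summable f := by
    refine Summable.of_norm ((summable_prod_of_nonneg fun p => norm_nonneg _).mpr ⟨fun X => ?_, ?_⟩)
    · refine ((hasSum_hookCount (fun k => ‖g k‖) X).summable.mul_left ‖weight θ y X‖).congr
        fun k => ?_
      simp [hf]
    · refine Summable.of_nonneg_of_le (fun X => tsum_nonneg fun k => norm_nonneg _) (fun X => ?_)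
        ((summable_weight_poly hθ hy (N + 1)).mul_left C)
      have : ∑' k, ‖f (X, k)‖ = ‖weight θ y X‖ * ∑ p ∈ pairs X, ‖g (p.1 - p.2).toNat‖ := by
        rw [← (hasSum_hookCount (fun k => ‖g k‖) X).tsum_eq, ← tsum_mul_left]
        exact tsum_congr fun k => by simp [hf]
      rw [this, mul_comm, ← mul_assoc]
      gcongr
      exact norm_hookSum_le hg X
  have h1 : HasSum (fun X => weight θ y X * hookSum g X) (∑' p, f p) :=
    hs.hasSum.prod_fiberwise fun X => by
      simpa [hf, hookSum] using (hasSum_hookCount g X).mul_left (weight θ y X)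
  have h2 : HasSum (fun k : ℕ+ =>
      k * g k * (y ^ (k : ℕ) / (1 - y ^ (k : ℕ))) * ∑' X, weight θ y X) (∑' p, f p) := by
    have hs' := (Equiv.prodComm _ _).hasSum_iff.mpr hs.hasSum
    refine hs'.prod_fiberwise fun k => ?_
    have h3 : HasSum (fun X => (hookCount k X : ℂ) * weight θ y X)
        (∑' X, hookCount k X * weight θ y X) := by
      refine Summable.hasSum (Summable.of_norm ?_)
      simpa using summable_hookCount_weight hθ hy k
    rw [tsum_hookCount_weight hθ hy k.pos] at h3
    refine (h3.mul_right (g k)).of_eq (fun X => ?_) (by ring)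
    simp [hf]; ring
  rw [mul_comm, ← tsum_mul_right, h2.tsum_eq]
  exact h1

end Maya

/-! ### Sums over functions on a finite index type -/

theorem summable_norm_pi_and_tsum {α : Type*} {n : ℕ} (f : Fin n → α → ℂ)
    (hf : ∀ r, Summable fun a => ‖f r a‖) :
    (Summable fun g : Fin n → α => ‖∏ r, f r (g r)‖) ∧
      ∑' g : Fin n → α, ∏ r, f r (g r) = ∏ r, ∑' a, f r a := by
  induction n with
  | zero => exact ⟨(hasSum_fintype _).summable, by simp⟩
  | succ n ih =>
    obtain ⟨h1, h2⟩ := ih (fun r => f r.succ) fun r => hf r.succ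
    have he : ∀ p : α × (Fin n → α), ∏ r, f r (Fin.consEquiv (fun _ => α) p r) =
        f 0 p.1 * ∏ r : Fin n, f r.succ (p.2 r) := fun p => by
      rw [Fin.prod_univ_succ]; simp [Fin.consEquiv]
    constructor
    · rw [← (Fin.consEquiv fun _ => α).summable_iff]
      refine ((hf 0).mul_of_nonneg h1 (fun _ => norm_nonneg _) fun _ => norm_nonneg _).congr
        fun p => ?_
      rw [Function.comp, he, norm_mul]
    · rw [← (Fin.consEquiv fun _ => α).tsum_eq, Fin.prod_univ_succ, ← h2,
        tsum_mul_tsum_of_summable_norm (hf 0) h1]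
      exact tsum_congr he

theorem hasSum_pi_prod {α : Type*} {n : ℕ} (f : Fin n → α → ℂ)
    (hf : ∀ r, Summable fun a => ‖f r a‖) :
    HasSum (fun g : Fin n → α => ∏ r, f r (g r)) (∏ r, ∑' a, f r a) := by
  obtain ⟨h1, h2⟩ := summable_norm_pi_and_tsum f hf
  rw [← h2]
  exact h1.of_norm.hasSum

/-- Expand the sum over `r`: each term alters a single factor of the product, and by `hK` that
factor is multiplied by the same `K` for every `r`. -/
theorem hasSum_pi_prod_mul_sum {α : Type*} {n : ℕ} (f h : Fin n → α → ℂ) (K : ℂ)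
    (hf : ∀ r, Summable fun a => ‖f r a‖) (hh : ∀ r, Summable fun a => ‖f r a * h r a‖)
    (hK : ∀ r, ∑' a, f r a * h r a = (∑' a, f r a) * K) :
    HasSum (fun g : Fin n → α => (∏ r, f r (g r)) * ∑ r, h r (g r))
      ((∏ r, ∑' a, f r a) * (n * K)) := by
  have key : ∀ r : Fin n, HasSum (fun g : Fin n → α => (∏ s, f s (g s)) * h r (g r))
      ((∏ s, ∑' a, f s a) * K) := by
    intro r
    have hs : ∀ s, Summable fun a => ‖f s a * if s = r then h r a else 1‖ := fun s => by
      by_cases hsr : s = r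
      · subst hsr; simpa using hh s
      · simpa [hsr] using hf s
    refine (hasSum_pi_prod _ hs).of_eq (fun g => ?_) ?_
    · rw [Finset.prod_mul_distrib, Finset.prod_ite_eq' Finset.univ r fun s => h r (g s)]
      simp
    · have : ∀ s, ∑' a, (f s a * if s = r then h r a else 1) =
          (∑' a, f s a) * if s = r then K else 1 := fun s => by
        by_cases hsr : s = r
        · subst hsr; simpa using hK s
        · simp [hsr]
      simp_rw [this]
      rw [Finset.prod_mul_distrib, Finset.prod_ite_eq' Finset.univ r fun _ => K]
      simp
  refine (hasSum_sum fun r (_ : r ∈ Finset.univ) => key r).of_eq (fun g => ?_) ?_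
  · rw [Finset.mul_sum]
  · simp; ring

/-! ### Self-conjugate partitions and their diagonal hooks -/

/-- The number of elements of `D` which are at least `m`. -/
def countGE (D : Finset ℕ) (m : ℕ) : ℕ := (D.filter fun d => m ≤ d).card

theorem countGE_eq_succ (D : Finset ℕ) (m : ℕ) :
    countGE D m = countGE D (m + 1) + if m ∈ D then 1 else 0 := by
  have : D.filter (fun d => m ≤ d) =
      D.filter (fun d => m + 1 ≤ d) ∪ D.filter (fun d => d = m) := by
    ext d; simp only [Finset.mem_filter, Finset.mem_union]; grind
  rw [countGE, this, Finset.card_union_of_disjoint, Finset.filter_eq']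
  · unfold countGE; split_ifs <;> simp
  · rw [Finset.disjoint_filter]; intro d _; omega

theorem countGE_le_add (D : Finset ℕ) (m k : ℕ) : countGE D m ≤ countGE D (m + k) + k := by
  induction k with
  | zero => simp
  | succ k ih =>
    have := countGE_eq_succ D (m + k)
    rw [add_assoc] at this
    split_ifs at this <;> omega

theorem countGE_anti (D : Finset ℕ) {m n : ℕ} (h : m ≤ n) : countGE D n ≤ countGE D m :=
  Finset.card_le_card fun d hd => by
    rw [Finset.mem_filter] at hd ⊢
    exact ⟨hd.1, h.trans hd.2⟩

theorem countGE_eq_zero (D : Finset ℕ) {m : ℕ} (h : D.sup id < m) : countGE D m = 0 := by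
  rw [countGE, Finset.card_eq_zero, Finset.filter_eq_empty_iff]
  intro d hd
  have : d ≤ D.sup id := Finset.le_sup (f := id) hd
  omega

theorem countGE_le_card (D : Finset ℕ) (m : ℕ) : countGE D m ≤ D.card :=
  Finset.card_filter_le _ _

namespace YoungDiagram

/-- The arm-lengths of the diagonal boxes. -/
def diagonalArms (μ : YoungDiagram) : Finset ℕ :=
  (μ.cells.filter fun c => c.1 ≤ c.2 ∧ (c.1, c.2 + 1) ∉ μ.cells).image fun c => c.2 - c.1

theorem mem_diagonalArms {μ : YoungDiagram} {m : ℕ} :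
    m ∈ μ.diagonalArms ↔ ∃ i, (i, i + m) ∈ μ ∧ (i, i + m + 1) ∉ μ := by
  simp only [diagonalArms, Finset.mem_image, Finset.mem_filter, Prod.exists, mem_cells]
  constructor
  · rintro ⟨i, j, ⟨h1, h2, h3⟩, rfl⟩
    refine ⟨i, ?_, ?_⟩ <;> rwa [Nat.add_sub_cancel' h2]
  · rintro ⟨i, h1, h2⟩
    exact ⟨i, i + m, ⟨h1, by omega, h2⟩, by omega⟩

/-- The boxes on the `m`-th superdiagonal form an initial segment. Passing from `m + 1` to `m`, it
grows by one box exactly when some row ends on superdiagonal `m`, that is, when `m` is a diagonal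
arm. -/
theorem mem_iff_lt_countGE (μ : YoungDiagram) (i m : ℕ) :
    (i, i + m) ∈ μ ↔ i < countGE μ.diagonalArms m := by
  -- Downward induction on `m`, starting where both sides are false.
  obtain ⟨k, hk⟩ : ∃ k, k = μ.rowLen 0 + μ.diagonalArms.sup id + 1 - m := ⟨_, rfl⟩
  induction k generalizing i m with
  | zero =>
    rw [countGE_eq_zero _ (by omega), mem_iff_lt_rowLen]
    have := μ.rowLen_anti 0 i (Nat.zero_le i)
    omega
  | succ k ih =>
    have ih' := fun i => ih i (m + 1) (by omega)
    set c := countGE μ.diagonalArms (m + 1) with hc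
    rw [countGE_eq_succ, ← hc]
    have h1 : m ∈ μ.diagonalArms ↔ (c, c + m) ∈ μ := by
      rw [mem_diagonalArms]
      constructor
      · rintro ⟨j, hj1, hj2⟩
        have : ¬ j < c := fun h => hj2 ((ih' j).mpr h)
        exact μ.up_left_mem (by omega) (by omega) hj1
      · intro h
        exact ⟨c, h, fun h' => lt_irrefl c ((ih' c).mp h')⟩
    rcases lt_trichotomy i c with h | rfl | h
    · have := μ.up_left_mem le_rfl (by omega : i + m ≤ i + (m + 1)) ((ih' i).mpr h)
      simp only [this, true_iff]
      omega
    · rw [← h1]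
      split_ifs with h2 <;> simp [h2]
    · have h2 : (i, i + m) ∉ μ := fun h' => by
        have := (ih' c).mp (μ.up_left_mem (by omega) (by omega) h')
        omega
      simp only [h2, false_iff]
      split_ifs <;> omega

/-- The self-conjugate partition with prescribed arm-lengths of the diagonal boxes. -/
def ofDiagonalArms (D : Finset ℕ) : YoungDiagram where
  cells := ((Finset.range (D.card + D.sup id + 1)) ×ˢ
    (Finset.range (D.card + D.sup id + 1))).filter
      fun c => min c.1 c.2 < countGE D (max c.1 c.2 - min c.1 c.2)
  isLowerSet := by
    rintro ⟨i, j⟩ ⟨i', j'⟩ hle h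
    obtain ⟨h1, h2⟩ : i' ≤ i ∧ j' ≤ j := hle
    simp only [Finset.coe_filter, Finset.mem_product, Finset.mem_range, Set.mem_ofPred_eq] at h ⊢
    refine ⟨by omega, ?_⟩
    -- If the smaller coordinate drops by `δ`, the distance to the diagonal grows by at most `δ`,
    -- and the count then drops by at most `δ`.
    have h3 := countGE_le_add D (max i j - min i j) (min i j - min i' j')
    have h4 := countGE_anti D
      (by omega : max i' j' - min i' j' ≤ max i j - min i j + (min i j - min i' j'))
    omega

theorem mem_ofDiagonalArms {D : Finset ℕ} {c : ℕ × ℕ} :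
    c ∈ ofDiagonalArms D ↔ min c.1 c.2 < countGE D (max c.1 c.2 - min c.1 c.2) := by
  rw [← mem_cells]
  simp only [ofDiagonalArms, Finset.mem_filter, Finset.mem_product, Finset.mem_range,
    and_iff_right_iff_imp]
  intro h
  have h1 := countGE_le_card D (max c.1 c.2 - min c.1 c.2)
  have h2 : ¬ D.sup id < max c.1 c.2 - min c.1 c.2 := fun h' => by
    rw [countGE_eq_zero D h'] at h; omega
  omega

theorem transpose_ofDiagonalArms (D : Finset ℕ) :
    (ofDiagonalArms D).transpose = ofDiagonalArms D := by
  ext c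
  rw [mem_cells, mem_cells, mem_transpose, mem_ofDiagonalArms, mem_ofDiagonalArms, Prod.fst_swap,
    Prod.snd_swap, min_comm, max_comm]

theorem mem_swap_of_selfConjugate {μ : YoungDiagram} (h : μ.transpose = μ) {i j : ℕ} :
    (i, j) ∈ μ ↔ (j, i) ∈ μ := by
  conv_lhs => rw [← h, mem_transpose, Prod.swap_prod_mk]

/-- Self-conjugate partitions correspond to finite sets of arm-lengths of diagonal boxes. -/
def selfConjugateEquiv : selfConjugate ≃ Finset ℕ where
  toFun μ := diagonalArms μ
  invFun D := ⟨ofDiagonalArms D, transpose_ofDiagonalArms D⟩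
  left_inv := by
    rintro ⟨μ, hμ⟩
    apply Subtype.ext
    ext ⟨i, j⟩
    rw [mem_cells, mem_cells, mem_ofDiagonalArms]
    rcases le_total i j with h | h
    · obtain ⟨m, rfl⟩ := Nat.exists_eq_add_of_le h
      rw [mem_iff_lt_countGE]
      simp
    · obtain ⟨m, rfl⟩ := Nat.exists_eq_add_of_le h
      rw [mem_swap_of_selfConjugate hμ, mem_iff_lt_countGE]
      simp
  right_inv D := by
    ext m
    rw [mem_diagonalArms]
    simp only [mem_ofDiagonalArms]
    have h1 := countGE_eq_succ D m
    have h2 : ∀ i, max i (i + m) - min i (i + m) = m := fun i => by omega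
    have h3 : ∀ i, max i (i + m + 1) - min i (i + m + 1) = m + 1 := fun i => by omega
    simp only [h2, h3]
    constructor
    · rintro ⟨i, h4, h5⟩
      by_contra h6
      rw [if_neg h6] at h1
      omega
    · intro h
      rw [if_pos h] at h1
      exact ⟨countGE D (m + 1), by omega, by omega⟩

/-- The arm of a diagonal box, with the box itself, meets each superdiagonal `0, …, d` once. -/
theorem sum_cells_upper {M : Type*} [AddCommMonoid M] (μ : YoungDiagram) (G : ℕ → M) :
    ∑ c ∈ μ.cells with c.1 ≤ c.2, G (c.2 - c.1) =
      ∑ d ∈ μ.diagonalArms, ∑ m ∈ Finset.range (d + 1), G m := by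
  set N := μ.diagonalArms.sup id + 1 with hN
  have hle : ∀ d ∈ μ.diagonalArms, d < N := fun d hd =>
    Nat.lt_succ_of_le (Finset.le_sup (f := id) hd)
  have h1 : ∑ c ∈ μ.cells with c.1 ≤ c.2, G (c.2 - c.1) =
      ∑ m ∈ Finset.range N, ∑ _i ∈ Finset.range (countGE μ.diagonalArms m), G m := by
    rw [Finset.sum_sigma']
    refine Finset.sum_bij' (fun c _ => (⟨c.2 - c.1, c.1⟩ : Σ _ : ℕ, ℕ))
      (fun p _ => (p.2, p.2 + p.1)) ?_ ?_ ?_ ?_ ?_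
    · rintro ⟨i, j⟩ h
      simp only [Finset.mem_filter, mem_cells] at h
      obtain ⟨m, rfl⟩ := Nat.exists_eq_add_of_le h.2
      have h3 := (mem_iff_lt_countGE μ i m).mp h.1
      simp only [Finset.mem_sigma, Finset.mem_range, Nat.add_sub_cancel_left]
      refine ⟨?_, h3⟩
      by_contra h4
      rw [countGE_eq_zero _ (by omega)] at h3
      omega
    · rintro ⟨m, i⟩ h
      simp only [Finset.mem_sigma, Finset.mem_range] at h
      simp only [Finset.mem_filter, mem_cells]
      exact ⟨(mem_iff_lt_countGE μ i m).mpr h.2, by omega⟩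
    · rintro ⟨i, j⟩ h
      simp only [Finset.mem_filter, mem_cells] at h
      simp only [Prod.mk.injEq, true_and]
      omega
    · rintro ⟨m, i⟩ h
      simp
    · rintro ⟨i, j⟩ h
      rfl
  rw [h1]
  have h2 : ∀ m, ∑ _i ∈ Finset.range (countGE μ.diagonalArms m), G m =
      ∑ d ∈ μ.diagonalArms, if m ≤ d then G m else 0 := fun m => by
    rw [Finset.sum_const, Finset.card_range, countGE, ← Finset.sum_filter, Finset.sum_const]
  simp_rw [h2]
  rw [Finset.sum_comm]
  refine Finset.sum_congr rfl fun d hd => ?_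
  rw [← Finset.sum_filter]
  refine Finset.sum_congr ?_ fun _ _ => rfl
  ext m
  have := hle d hd
  simp only [Finset.mem_filter, Finset.mem_range]
  omega

/-- A diagonal hook has equal arm and leg, which share the diagonal box; hence the subtracted `G 0`.
-/
theorem sum_cells_selfConjugate {μ : YoungDiagram} (hμ : μ.transpose = μ) (F : ℕ × ℕ → ℤ)
    (G : ℕ → ℤ) (h1 : ∀ i m, F (i, i + m) = G m) (h2 : ∀ i m, F (i + m, i) = G m) :
    ∑ c ∈ μ.cells, F c =
      ∑ d ∈ μ.diagonalArms, (2 * ∑ m ∈ Finset.range (d + 1), G m - G 0) := by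
  have e1 : ∑ c ∈ μ.cells with c.1 ≤ c.2, F c =
      ∑ d ∈ μ.diagonalArms, ∑ m ∈ Finset.range (d + 1), G m := by
    rw [← sum_cells_upper]
    refine Finset.sum_congr rfl ?_
    rintro ⟨i, j⟩ h
    have hij : i ≤ j := (Finset.mem_filter.mp h).2
    obtain ⟨m, rfl⟩ := Nat.exists_eq_add_of_le hij
    rw [h1]; simp
  have e2 : ∑ c ∈ μ.cells with ¬ c.1 ≤ c.2, F c =
      ∑ c ∈ μ.cells with c.1 ≤ c.2, if c.2 - c.1 = 0 then 0 else G (c.2 - c.1) := by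
    rw [← Finset.sum_filter_of_ne (p := fun c : ℕ × ℕ => c.1 < c.2)
      (s := μ.cells.filter fun c => c.1 ≤ c.2)
      (fun c hc h => by
        have := (Finset.mem_filter.mp hc).2
        by_contra h'
        exact h (if_pos (by omega))), Finset.filter_filter]
    refine Finset.sum_bij' (fun c _ => c.swap) (fun c _ => c.swap) ?_ ?_ ?_ ?_ ?_
    · rintro ⟨i, j⟩ h
      simp only [Finset.mem_filter, mem_cells, Prod.swap_prod_mk] at h ⊢
      exact ⟨(mem_swap_of_selfConjugate hμ).mp h.1, by omega, by omega⟩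
    · rintro ⟨i, j⟩ h
      simp only [Finset.mem_filter, mem_cells, Prod.swap_prod_mk] at h ⊢
      exact ⟨(mem_swap_of_selfConjugate hμ).mp h.1, by omega⟩
    · intro c _; simp
    · intro c _; simp
    · rintro ⟨i, j⟩ h
      have h3 := (Finset.mem_filter.mp h).2
      simp only [not_le] at h3
      obtain ⟨m, rfl⟩ := Nat.exists_eq_add_of_le h3.le
      rw [h2]
      simp only [Prod.swap_prod_mk, Nat.add_sub_cancel_left]
      rw [if_neg (by omega)]
  rw [← Finset.sum_filter_add_sum_filter_not μ.cells (fun c => c.1 ≤ c.2), e1, e2,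
    sum_cells_upper μ (fun m => if m = 0 then 0 else G m), ← Finset.sum_add_distrib]
  refine Finset.sum_congr rfl fun d _ => ?_
  rw [Finset.sum_range_succ' G, Finset.sum_range_succ']
  simp
  ring

/-! ### Size and BG-rank from the diagonal arms -/

theorem card_selfConjugate {μ : YoungDiagram} (hμ : μ.transpose = μ) :
    μ.card = ∑ d ∈ μ.diagonalArms, (2 * d + 1) := by
  have := sum_cells_selfConjugate hμ (fun _ => 1) (fun _ => 1) (fun _ _ => rfl) fun _ _ => rfl
  zify
  simp only [Finset.sum_const, nsmul_eq_mul, mul_one, Finset.card_range] at this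
  rw [this]
  refine Finset.sum_congr rfl fun d _ => ?_
  push_cast
  ring

theorem bgRank_selfConjugate {μ : YoungDiagram} (hμ : μ.transpose = μ) :
    μ.bgRank = ∑ d ∈ μ.diagonalArms, (-1) ^ d := by
  have e : ∀ i m : ℕ, (-1 : ℤ) ^ (i + (i + m)) = (-1) ^ m := fun i m => by
    rw [← add_assoc, pow_add, ← two_mul, pow_mul]; simp
  rw [bgRank, sum_cells_selfConjugate hμ _ (fun m => (-1) ^ m) (fun i m => e i m)
    fun i m => by rw [← e i m]; ring_nf]
  have h : ∀ d : ℕ, 2 * ∑ m ∈ Finset.range (d + 1), (-1 : ℤ) ^ m - (-1) ^ 0 = (-1) ^ d := by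
    intro d
    induction d with
    | zero => simp
    | succ d ih => rw [Finset.sum_range_succ, pow_succ]; linarith
  exact Finset.sum_congr rfl fun d _ => h d

end YoungDiagram

/-! ### Hook-lengths and Maya diagrams -/

namespace Maya

/-- The natural number `n` or `-1 - n`. -/
def mag (n : ℤ) : ℕ := if n < 0 then (-1 - n).toNat else n.toNat

theorem mag_natCast (m : ℕ) : mag m = m := by simp [mag]

theorem mag_mirror (n : ℤ) : mag (-1 - n) = mag n := by
  unfold mag; split_ifs <;> omega

theorem mag_eq_mag {a b : ℤ} (h : mag a = mag b) : a = b ∨ a = -1 - b := by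
  unfold mag at h; split_ifs at h <;> omega

/-- The Maya diagram, symmetric under `n ↦ -1 - n` up to exchanging beads and gaps, with
nonnegative beads `D`. -/
def double (D : Finset ℕ) : Finset ℤ :=
  D.image (fun m : ℕ => (m : ℤ)) ∪ D.image fun m : ℕ => -1 - (m : ℤ)

theorem mem_double {D : Finset ℕ} {n : ℤ} : n ∈ double D ↔ mag n ∈ D := by
  simp only [double, Finset.mem_union, Finset.mem_image]
  constructor
  · rintro (⟨m, hm, rfl⟩ | ⟨m, hm, rfl⟩)
    · rwa [mag_natCast]
    · rwa [mag_mirror, mag_natCast]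
  · intro h
    rcases lt_or_ge n 0 with hn | hn
    · exact Or.inr ⟨_, h, by unfold mag; rw [if_pos hn]; omega⟩
    · exact Or.inl ⟨_, h, by unfold mag; rw [if_neg hn.not_gt]; omega⟩

theorem bead_double {D : Finset ℕ} {n : ℤ} : bead (double D) n ↔ ¬ (mag n ∈ D ↔ n < 0) := by
  rw [bead, mem_double]

theorem bead_double_mirror {D : Finset ℕ} {n : ℤ} :
    bead (double D) (-1 - n) ↔ ¬ bead (double D) n := by
  rw [bead_double, bead_double, mag_mirror]
  have : -1 - n < 0 ↔ ¬ n < 0 := by omega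
  rw [this]; tauto

end Maya

namespace YoungDiagram

open Maya

variable {μ : YoungDiagram}

/-- The bead belonging to the `i`-th row. -/
def rowBead (μ : YoungDiagram) (i : ℕ) : ℤ := μ.rowLen i - i - 1

/-- The gap belonging to the `j`-th column. -/
def colGap (μ : YoungDiagram) (j : ℕ) : ℤ := j - μ.colLen j

/-- The difference is `(rowLen i - j) + (colLen j - i) - 1`: at least `1` inside the diagram, where
it is the hook-length, and at most `-1` outside. -/
theorem colGap_lt_rowBead_iff {i j : ℕ} : μ.colGap j < μ.rowBead i ↔ (i, j) ∈ μ := by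
  unfold colGap rowBead
  constructor
  · intro h
    by_contra h'
    have h1 := mt mem_iff_lt_rowLen.mpr h'
    have h2 := mt mem_iff_lt_colLen.mpr h'
    omega
  · intro h
    have h1 := mem_iff_lt_rowLen.mp h
    have h2 := mem_iff_lt_colLen.mp h
    omega

theorem rowBead_ne_colGap (i j : ℕ) : μ.rowBead i ≠ μ.colGap j := by
  intro h
  have h3 : (i, j) ∉ μ := fun h' => (colGap_lt_rowBead_iff.mpr h').ne' h
  have h1 := mt mem_iff_lt_rowLen.mpr h3
  have h2 := mt mem_iff_lt_colLen.mpr h3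
  unfold colGap rowBead at h
  omega

theorem exists_rowBead_or_colGap (μ : YoungDiagram) (n : ℤ) :
    (∃ i, μ.rowBead i = n) ∨ ∃ j, μ.colGap j = n := by
  classical
  have hex : ∃ i, μ.rowBead i ≤ n := by
    refine ⟨(μ.rowLen 0 - 1 - n).toNat, ?_⟩
    have := μ.rowLen_anti 0 (μ.rowLen 0 - 1 - n).toNat (Nat.zero_le _)
    unfold rowBead
    omega
  set i := Nat.find hex with hi
  have h1 : μ.rowBead i ≤ n := Nat.find_spec hex
  rcases h1.eq_or_lt with h | h
  · exact Or.inl ⟨i, h⟩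
  · unfold rowBead at h
    -- As `i` is the first row with bead at most `n`, column `n + i` has length exactly `i`.
    refine Or.inr ⟨(n + i).toNat, ?_⟩
    have h2 : (i, (n + i).toNat) ∉ μ := by rw [mem_iff_lt_rowLen]; omega
    have h3 : i ≤ μ.colLen (n + i).toNat := by
      rcases Nat.eq_zero_or_pos i with h0 | h0
      · omega
      · have h4 : ¬ μ.rowBead (i - 1) ≤ n := Nat.find_min hex (by omega)
        unfold rowBead at h4
        have h5 : (i - 1, (n + i).toNat) ∈ μ := by rw [mem_iff_lt_rowLen]; omega
        have := mem_iff_lt_colLen.mp h5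
        omega
    rw [mem_iff_lt_colLen] at h2
    unfold colGap
    omega

theorem rowBead_strictAnti (μ : YoungDiagram) : StrictAnti μ.rowBead := by
  intro i j h
  have := μ.rowLen_anti i j h.le
  unfold rowBead
  omega

theorem colGap_strictMono (μ : YoungDiagram) : StrictMono μ.colGap := by
  intro i j h
  have := μ.colLen_anti i j h.le
  unfold colGap
  omega

theorem mem_diagonalArms_iff_rowBead {m : ℕ} :
    m ∈ μ.diagonalArms ↔ ∃ i, μ.rowBead i = m := by
  rw [mem_diagonalArms]
  refine exists_congr fun i => ?_
  rw [mem_iff_lt_rowLen, mem_iff_lt_rowLen]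
  unfold rowBead
  omega

/-- Conjugation symmetry gives `colGap j = -1 - rowBead j`, so the nonnegative row beads, which are
the diagonal arms, determine the negative gaps. -/
theorem bead_double_diagonalArms (hμ : μ.transpose = μ) (n : ℤ) :
    bead (double μ.diagonalArms) n ↔ ∃ i, μ.rowBead i = n := by
  have hcol : ∀ j, μ.colGap j = -1 - μ.rowBead j := fun j => by
    have : μ.colLen j = μ.rowLen j := by rw [← colLen_transpose, hμ]
    unfold colGap rowBead
    rw [this]; ring
  have hgap : (∃ j, μ.colGap j = n) ↔ ¬ ∃ i, μ.rowBead i = n := by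
    constructor
    · rintro ⟨j, rfl⟩ ⟨i, h⟩
      exact rowBead_ne_colGap i j h
    · exact fun h => (exists_rowBead_or_colGap μ n).resolve_left h
  rw [bead_double, mem_diagonalArms_iff_rowBead]
  rcases lt_or_ge n 0 with hn | hn
  · have h1 : ((mag n : ℕ) : ℤ) = -1 - n := by unfold mag; rw [if_pos hn]; omega
    have h2 : (∃ i, μ.rowBead i = mag n) ↔ ∃ j, μ.colGap j = n := by
      refine exists_congr fun i => ?_
      rw [h1, hcol]; omega
    rw [h2, hgap]
    simp [hn]
  · have h1 : ((mag n : ℕ) : ℤ) = n := by unfold mag; rw [if_neg hn.not_gt]; omega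
    rw [h1]
    simp [hn.not_gt]

theorem arm_eq {i j : ℕ} : μ.arm (i, j) = μ.rowLen i - (j + 1) := by
  have : (μ.cells.filter fun u => u.1 = i ∧ j < u.2) = {i} ×ˢ Finset.Ico (j + 1) (μ.rowLen i) := by
    ext ⟨a, b⟩
    simp only [Finset.mem_filter, mem_cells, Finset.mem_product, Finset.mem_singleton,
      Finset.mem_Ico]
    constructor
    · rintro ⟨h1, rfl, h2⟩
      exact ⟨rfl, h2, mem_iff_lt_rowLen.mp h1⟩
    · rintro ⟨rfl, h2, h1⟩
      exact ⟨mem_iff_lt_rowLen.mpr h1, rfl, h2⟩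
  rw [arm, this]; simp

theorem leg_eq {i j : ℕ} : μ.leg (i, j) = μ.colLen j - (i + 1) := by
  have : (μ.cells.filter fun u => u.2 = j ∧ i < u.1) = Finset.Ico (i + 1) (μ.colLen j) ×ˢ {j} := by
    ext ⟨a, b⟩
    simp only [Finset.mem_filter, mem_cells, Finset.mem_product, Finset.mem_singleton,
      Finset.mem_Ico]
    constructor
    · rintro ⟨h1, rfl, h2⟩
      exact ⟨⟨h2, mem_iff_lt_colLen.mp h1⟩, rfl⟩
    · rintro ⟨⟨h2, h1⟩, rfl⟩
      exact ⟨mem_iff_lt_colLen.mpr h1, rfl, h2⟩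
  rw [leg, this]; simp

theorem hookLength_eq {i j : ℕ} (h : (i, j) ∈ μ) :
    μ.hookLength (i, j) = (μ.rowBead i - μ.colGap j).toNat := by
  have h1 := mem_iff_lt_rowLen.mp h
  have h2 := mem_iff_lt_colLen.mp h
  rw [hookLength, arm_eq, leg_eq]
  unfold rowBead colGap
  omega

theorem sum_hookLength {M : Type*} [AddCommMonoid M] (hμ : μ.transpose = μ) (F : ℕ → M) :
    ∑ c ∈ μ.cells, F (μ.hookLength c) =
      ∑ p ∈ pairs (double μ.diagonalArms), F (p.1 - p.2).toNat := by
  have hb := bead_double_diagonalArms hμ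
  refine Finset.sum_bij (fun c _ => (μ.rowBead c.1, μ.colGap c.2)) ?_ ?_ ?_ ?_
  · rintro ⟨i, j⟩ h
    rw [mem_pairs, hb, hb]
    refine ⟨⟨i, rfl⟩, ?_, colGap_lt_rowBead_iff.mpr h⟩
    rintro ⟨i', h'⟩
    exact rowBead_ne_colGap _ _ h'
  · rintro ⟨i, j⟩ _ ⟨i', j'⟩ _ h
    simp only [Prod.mk.injEq] at h
    rw [(rowBead_strictAnti μ).injective h.1, (colGap_strictMono μ).injective h.2]
  · rintro ⟨a, b⟩ h
    rw [mem_pairs, hb, hb] at h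
    obtain ⟨⟨i, hi⟩, h2, h3⟩ := h
    obtain ⟨j, hj⟩ := (exists_rowBead_or_colGap μ b).resolve_left h2
    simp only at hi hj h3
    subst hi hj
    exact ⟨(i, j), colGap_lt_rowBead_iff.mp h3, rfl⟩
  · rintro ⟨i, j⟩ h
    rw [hookLength_eq h]

theorem sum_map_hooksMod {M : Type*} [AddCommMonoid M] (hμ : μ.transpose = μ) (t : ℕ) (F : ℕ → M) :
    ((μ.hooksMod t).map F).sum =
      ∑ p ∈ pairs (double μ.diagonalArms) with (t : ℤ) ∣ p.1 - p.2, F (p.1 - p.2).toNat := by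
  rw [Finset.sum_filter, hooksMod, hooks, Multiset.filter_map, Multiset.map_map]
  have h1 : (Multiset.map (F ∘ μ.hookLength)
      (Multiset.filter ((fun h => t ∣ h) ∘ μ.hookLength) μ.cells.val)).sum =
      ∑ c ∈ μ.cells with t ∣ μ.hookLength c, F (μ.hookLength c) := rfl
  rw [h1, Finset.sum_filter, sum_hookLength hμ fun h => if t ∣ h then F h else 0]
  refine Finset.sum_congr rfl fun p hp => if_congr ?_ rfl rfl
  have := (mem_pairs.mp hp).2.2
  rw [← Int.natCast_dvd_natCast, Int.toNat_of_nonneg (by omega)]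

end YoungDiagram

/-! ### The quotient of a symmetric Maya diagram -/

namespace Maya

theorem mul_add_lt_zero_iff {s r k : ℤ} (h0 : 0 ≤ r) (h1 : r < 2 * s) :
    2 * s * k + r < 0 ↔ k < 0 := by
  constructor
  · intro h
    by_contra hk
    have := mul_nonneg (by omega : 0 ≤ 2 * s) (not_lt.mp hk)
    omega
  · intro h
    have := mul_le_mul_of_nonneg_left (by omega : k ≤ -1) (by omega : 0 ≤ 2 * s)
    omega

theorem mul_add_ediv {s r k : ℤ} (h0 : 0 ≤ r) (h1 : r < 2 * s) : (2 * s * k + r) / (2 * s) = k := by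
  rw [add_comm, Int.add_mul_ediv_left _ _ (by omega), Int.ediv_eq_zero_of_lt h0 h1, zero_add]

theorem mul_add_emod {s r k : ℤ} (h0 : 0 ≤ r) (h1 : r < 2 * s) : (2 * s * k + r) % (2 * s) = r := by
  rw [add_comm, Int.add_mul_emod_self_left, Int.emod_eq_of_lt h0 h1]

theorem emod_mirror {t : ℤ} (ht : 0 < t) (b : ℤ) : (-1 - b) % t = t - 1 - b % t := by
  have h1 := Int.emod_add_mul_ediv b t
  have h2 : -1 - b = (t - 1 - b % t) + t * (-1 - b / t) := by linarith
  have := Int.emod_nonneg b ht.ne'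
  have := Int.emod_lt_of_pos b ht
  rw [h2, Int.add_mul_emod_self_left, Int.emod_eq_of_lt (by omega) (by omega)]

/-- Exactly one of `m` and `-1 - m` has residue below `s` modulo `2 * s`, since the mirror sends
residue `r` to `2 * s - 1 - r`. -/
theorem bijective_runner {s : ℕ} (hs : 0 < s) :
    Function.Bijective fun p : Fin s × ℤ => mag (2 * s * p.2 + (p.1 : ℕ)) := by
  constructor
  · rintro ⟨⟨r, hr⟩, k⟩ ⟨⟨r', hr'⟩, k'⟩ h
    simp only at h
    have e1 := mul_add_emod (s := s) (r := r) (k := k) (by omega) (by omega)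
    have e2 := mul_add_emod (s := s) (r := r') (k := k') (by omega) (by omega)
    have d1 := mul_add_ediv (s := s) (r := r) (k := k) (by omega) (by omega)
    have d2 := mul_add_ediv (s := s) (r := r') (k := k') (by omega) (by omega)
    rcases mag_eq_mag h with h | h
    · rw [h, e2] at e1
      rw [h, d2] at d1
      simp only [Prod.mk.injEq, Fin.mk.injEq]
      omega
    · rw [h, emod_mirror (by omega), e2] at e1
      omega
  · intro m
    have h1 := Int.emod_add_mul_ediv m (2 * s)
    have h2 := Int.emod_nonneg m (by omega : (2 * s : ℤ) ≠ 0)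
    have h3 := Int.emod_lt_of_pos m (by omega : (0 : ℤ) < 2 * s)
    rcases lt_or_ge ((m : ℤ) % (2 * s)) s with h | h
    · refine ⟨(⟨((m : ℤ) % (2 * s)).toNat, by omega⟩, (m : ℤ) / (2 * s)), ?_⟩
      simp only
      rw [Int.toNat_of_nonneg h2, add_comm, h1, mag_natCast]
    · refine ⟨(⟨(2 * s - 1 - (m : ℤ) % (2 * s)).toNat, by omega⟩, -1 - (m : ℤ) / (2 * s)), ?_⟩
      simp only
      have h4 : 2 * s * (-1 - (m : ℤ) / (2 * s)) + (2 * s - 1 - (m : ℤ) % (2 * s)) = -1 - m := by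
        linarith
      rw [Int.toNat_of_nonneg (by omega), h4, mag_mirror, mag_natCast]

/-- The positions on the runners `0, …, s - 1` modulo `2 * s`, up to the symmetry `n ↦ -1 - n`. -/
def runnerEquiv {s : ℕ} (hs : 0 < s) : Fin s × ℤ ≃ ℕ := Equiv.ofBijective _ (bijective_runner hs)

theorem runnerEquiv_apply {s : ℕ} (hs : 0 < s) (r : Fin s) (k : ℤ) :
    runnerEquiv hs (r, k) = mag (2 * s * k + (r : ℕ)) := rfl

theorem runnerEquiv_injOn {s : ℕ} (hs : 0 < s) (r : Fin s) (S : Set ℤ) :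
    Set.InjOn (fun k => runnerEquiv hs (r, k)) S := fun k _ l _ h => by
  simpa using (runnerEquiv hs).injective h

/-- The quotient of a symmetric Maya diagram by `2 * s`, given by the runners `0, …, s - 1`. -/
def quotientEquiv {s : ℕ} (hs : 0 < s) : Finset ℕ ≃ (Fin s → Finset ℤ) where
  toFun D r := D.preimage (fun k => runnerEquiv hs (r, k)) (runnerEquiv_injOn hs r _)
  invFun f := Finset.univ.biUnion fun r => (f r).image fun k => runnerEquiv hs (r, k)
  left_inv D := by
    ext m
    obtain ⟨⟨r, k⟩, rfl⟩ := (runnerEquiv hs).surjective m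
    simp
  right_inv f := by
    funext r
    ext k
    exact Finset.mem_preimage.trans (by simp)

theorem mem_quotientEquiv {s : ℕ} {hs : 0 < s} {D : Finset ℕ} {r : Fin s} {k : ℤ} :
    k ∈ quotientEquiv hs D r ↔ mag (2 * s * k + (r : ℕ)) ∈ D :=
  Finset.mem_preimage (hf := runnerEquiv_injOn hs r _)

theorem sum_quotientEquiv {M : Type*} [AddCommMonoid M] {s : ℕ} (hs : 0 < s) (D : Finset ℕ)
    (g : ℕ → M) :
    ∑ d ∈ D, g d = ∑ r, ∑ k ∈ quotientEquiv hs D r, g (mag (2 * s * k + (r : ℕ))) := by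
  rw [Finset.sum_sigma']
  symm
  refine Finset.sum_bij (fun p _ => runnerEquiv hs (p.1, p.2)) ?_ ?_ ?_ ?_
  · rintro ⟨r, k⟩ h
    simpa [runnerEquiv_apply, mem_quotientEquiv] using h
  · rintro ⟨r, k⟩ _ ⟨r', k'⟩ _ h
    have := (runnerEquiv hs).injective h
    simp only [Prod.mk.injEq] at this
    obtain ⟨rfl, rfl⟩ := this
    rfl
  · intro m hm
    obtain ⟨⟨r, k⟩, rfl⟩ := (runnerEquiv hs).surjective m
    exact ⟨⟨r, k⟩, by simpa [runnerEquiv_apply, mem_quotientEquiv] using hm, rfl⟩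
  · rintro ⟨r, k⟩ _
    rfl

theorem bead_quotientEquiv {s : ℕ} {hs : 0 < s} {D : Finset ℕ} {r : Fin s} {k : ℤ} :
    bead (quotientEquiv hs D r) k ↔ bead (double D) (2 * s * k + (r : ℕ)) := by
  rw [bead, bead, mem_quotientEquiv, mem_double, mul_add_lt_zero_iff (by omega) (by omega)]

theorem sum_pairs_double {M : Type*} [AddCommMonoid M] {s : ℕ} (hs : 0 < s) (D : Finset ℕ)
    (F : ℕ → M) :
    ∑ p ∈ pairs (double D) with ((2 * s : ℕ) : ℤ) ∣ p.1 - p.2, F (p.1 - p.2).toNat =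
      2 • ∑ r, ∑ p ∈ pairs (quotientEquiv hs D r), F (2 * s * (p.1 - p.2).toNat) := by
  -- Pairs on the runners below `s` give the quotient's pairs; the mirror `(a, b) ↦ (-1 - b, -1 -
  -- a)` preserves differences and carries the remaining pairs to these.
  have ht : (0 : ℤ) < 2 * s := by omega
  rw [← Finset.sum_filter_add_sum_filter_not _ (fun p : ℤ × ℤ => p.1 % (2 * s) < s), two_smul]
  have key : ∑ p ∈ (pairs (double D)).filter (fun p => ((2 * s : ℕ) : ℤ) ∣ p.1 - p.2) with
      p.1 % (2 * s : ℤ) < s, F (p.1 - p.2).toNat =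
      ∑ r, ∑ p ∈ pairs (quotientEquiv hs D r), F (2 * s * (p.1 - p.2).toNat) := by
    rw [Finset.sum_sigma']
    symm
    refine Finset.sum_bij (fun p _ => (2 * s * p.2.1 + (p.1 : ℕ), 2 * s * p.2.2 + (p.1 : ℕ)))
      ?_ ?_ ?_ ?_
    · rintro ⟨r, k, l⟩ h
      simp only [Finset.mem_sigma, Finset.mem_univ, true_and, mem_pairs, bead_quotientEquiv] at h
      simp only [Finset.mem_filter, mem_pairs]
      refine ⟨⟨⟨h.1, h.2.1, ?_⟩, ?_⟩, ?_⟩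
      · have := mul_lt_mul_of_pos_left h.2.2 ht
        omega
      · exact ⟨k - l, by push_cast; ring⟩
      · rw [mul_add_emod (by omega) (by omega)]
        omega
    · rintro ⟨r, k, l⟩ _ ⟨r', k', l'⟩ _ h
      simp only [Prod.mk.injEq] at h
      have e1 := mul_add_emod (s := s) (r := (r : ℕ)) (k := k) (by omega) (by omega)
      have e2 := mul_add_ediv (s := s) (r := (r : ℕ)) (k := k) (by omega) (by omega)
      have e3 := mul_add_ediv (s := s) (r := (r : ℕ)) (k := l) (by omega) (by omega)
      rw [h.1, mul_add_emod (by omega) (by omega)] at e1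
      rw [h.1, mul_add_ediv (by omega) (by omega)] at e2
      rw [h.2, mul_add_ediv (by omega) (by omega)] at e3
      obtain rfl : r' = r := Fin.ext (by omega)
      rw [e2, e3]
    · rintro ⟨a, b⟩ h
      simp only [Finset.mem_filter, mem_pairs] at h
      obtain ⟨⟨⟨h1, h2, h3⟩, h4⟩, h5⟩ := h
      have ha := Int.emod_add_mul_ediv a (2 * s)
      have hb := Int.emod_add_mul_ediv b (2 * s)
      have hab : b % (2 * s) = a % (2 * s) := by
        push_cast at h4
        exact (Int.emod_eq_emod_iff_emod_sub_eq_zero.mpr (Int.emod_eq_zero_of_dvd h4)).symm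
      have h0 := Int.emod_nonneg a ht.ne'
      have ea : 2 * s * (a / (2 * s)) + ((a % (2 * s)).toNat : ℤ) = a := by
        rw [Int.toNat_of_nonneg h0]; linarith
      have eb : 2 * s * (b / (2 * s)) + ((a % (2 * s)).toNat : ℤ) = b := by
        rw [Int.toNat_of_nonneg h0]; linarith
      refine ⟨⟨⟨(a % (2 * s)).toNat, by omega⟩, a / (2 * s), b / (2 * s)⟩, ?_, ?_⟩
      · simp only [Finset.mem_sigma, Finset.mem_univ, true_and, mem_pairs, bead_quotientEquiv]
        rw [ea, eb]
        refine ⟨h1, h2, ?_⟩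
        by_contra h6
        have := mul_le_mul_of_nonneg_left (not_lt.mp h6) ht.le
        omega
      · simp only [ea, eb]
    · rintro ⟨r, k, l⟩ h
      simp only [Finset.mem_sigma, Finset.mem_univ, true_and, mem_pairs] at h
      congr 1
      zify
      rw [Int.toNat_of_nonneg (by omega), Int.toNat_of_nonneg]
      · ring
      · have := mul_lt_mul_of_pos_left h.2.2 ht
        omega
  rw [← key]
  congr 1
  refine Finset.sum_bij' (fun p _ => (-1 - p.2, -1 - p.1)) (fun p _ => (-1 - p.2, -1 - p.1))
    ?_ ?_ ?_ ?_ ?_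
  · rintro ⟨a, b⟩ h
    simp only [Finset.mem_filter, mem_pairs, bead_double_mirror, not_not] at h ⊢
    obtain ⟨⟨⟨h1, h2, h3⟩, h4⟩, h5⟩ := h
    refine ⟨⟨⟨h2, h1, by omega⟩, by convert h4 using 1; ring⟩, ?_⟩
    have hab : a % (2 * s) = b % (2 * s) :=
      Int.emod_eq_emod_iff_emod_sub_eq_zero.mpr (Int.emod_eq_zero_of_dvd (by exact_mod_cast h4))
    rw [emod_mirror ht]
    omega
  · rintro ⟨a, b⟩ h
    simp only [Finset.mem_filter, mem_pairs, bead_double_mirror, not_not] at h ⊢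
    obtain ⟨⟨⟨h1, h2, h3⟩, h4⟩, h5⟩ := h
    refine ⟨⟨⟨h2, h1, by omega⟩, by convert h4 using 1; ring⟩, ?_⟩
    have hab : a % (2 * s) = b % (2 * s) :=
      Int.emod_eq_emod_iff_emod_sub_eq_zero.mpr (Int.emod_eq_zero_of_dvd (by exact_mod_cast h4))
    rw [emod_mirror ht]
    omega
  · intro p _; simp
  · intro p _; simp
  · rintro ⟨a, b⟩ _
    congr 2
    simp only
    ring

/-! #### The statistics of a single runner -/

/-- The contribution of the charge `c` of the runner `r` to the size of a partition. -/
def coreSize (s r : ℕ) (c : ℤ) : ℕ := (2 * s * c ^ 2 + (2 * r + 1 - 2 * s) * c).toNat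

/-- The quadratic is nonnegative at every integer when `r < s`, so the truncation in `coreSize`
loses nothing. -/
theorem coreSize_cast {s r : ℕ} (hr : r < s) (c : ℤ) :
    (coreSize s r c : ℤ) = 2 * s * c ^ 2 + (2 * r + 1 - 2 * s) * c := by
  refine Int.toNat_of_nonneg ?_
  rcases le_or_gt c 0 with h | h
  · have h1 : 0 ≤ (2 * (s : ℤ) - 1 - 2 * r) * (-c) := mul_nonneg (by omega) (by omega)
    have h2 : 0 ≤ 2 * (s : ℤ) * c ^ 2 := by positivity
    linarith
  · have h1 : 0 ≤ 2 * (s : ℤ) * (c * (c - 1)) :=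
      mul_nonneg (by omega) (mul_nonneg (by omega) (by omega))
    have h2 : 0 ≤ (2 * (r : ℤ) + 1) * c := mul_nonneg (by omega) (by omega)
    linarith

/-- Up to the sign of `k < 0`, each position contributes `2 * s * (2 * k + 1) + (2 * r + 1 - 2 *
s)`: an energy term and a charge term. -/
theorem sum_size_runner {s r : ℕ} (hr : r < s) (X : Finset ℤ) :
    ∑ k ∈ X, (2 * mag (2 * s * k + r) + 1) = 4 * s * inv X + coreSize s r (charge X) := by
  zify
  rw [coreSize_cast hr]
  have h1 : ∑ k ∈ X, (2 * (mag (2 * s * k + r) : ℤ) + 1) =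
      2 * s * wsum (fun n => 2 * n + 1) X + (2 * r + 1 - 2 * s) * charge X := by
    rw [charge, wsum, wsum, Finset.mul_sum, Finset.mul_sum, ← Finset.sum_add_distrib]
    refine Finset.sum_congr rfl fun k _ => ?_
    have h2 := mul_add_lt_zero_iff (s := s) (r := r) (k := k) (by omega) (by omega)
    rcases lt_or_ge k 0 with hk | hk
    · rw [mag, if_pos (h2.mpr hk), if_pos hk, if_pos hk, Int.toNat_of_nonneg]
      · ring
      · have := h2.mpr hk; omega
    · have h3 := mt h2.mp hk.not_gt
      rw [mag, if_neg h3, if_neg hk.not_gt, if_neg hk.not_gt, Int.toNat_of_nonneg (not_lt.mp h3)]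
      ring
  rw [h1, wsum_energy]
  ring

/-- The modulus is even, so `mag` has the parity of `r` for `k ≥ 0` and the opposite parity for `k <
0`, matching the signs in the charge. -/
theorem sum_sign_runner {s r : ℕ} (hr : r < s) (X : Finset ℤ) :
    ∑ k ∈ X, (-1 : ℤ) ^ mag (2 * s * k + r) = (-1) ^ r * charge X := by
  rw [charge, wsum, Finset.mul_sum]
  refine Finset.sum_congr rfl fun k _ => ?_
  have h2 := mul_add_lt_zero_iff (s := s) (r := r) (k := k) (by omega) (by omega)
  rcases lt_or_ge k 0 with hk | hk
  · have h3 := h2.mpr hk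
    have h4 : mag (2 * s * k + r) + r + 1 = 2 * (s * (-k).toNat) := by
      rw [mag, if_pos h3]
      zify
      rw [Int.toNat_of_nonneg (by omega), Int.toNat_of_nonneg (by omega)]
      ring
    have h5 : (-1 : ℤ) ^ mag (2 * s * k + r) * (-1) ^ r * (-1) = 1 := by
      rw [← pow_add, ← pow_succ, h4, pow_mul]; simp
    have h6 : (-1 : ℤ) ^ r * (-1) ^ r = 1 := by rw [← pow_add, ← two_mul, pow_mul]; simp
    rw [if_pos hk]
    calc (-1 : ℤ) ^ mag (2 * s * k + r)
        = (-1 : ℤ) ^ mag (2 * s * k + r) * ((-1) ^ r * (-1) ^ r) := by rw [h6, mul_one]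
      _ = ((-1 : ℤ) ^ mag (2 * s * k + r) * (-1) ^ r * (-1)) * ((-1) ^ r * -1) := by ring
      _ = _ := by rw [h5, one_mul]
  · have h3 := mt h2.mp hk.not_gt
    have h4 : mag (2 * s * k + r) = 2 * (s * k.toNat) + r := by
      rw [mag, if_neg h3]
      zify
      rw [Int.toNat_of_nonneg (by omega), Int.toNat_of_nonneg (by omega)]
      ring
    rw [if_neg hk.not_gt, h4, pow_add, pow_mul]
    simp

end Maya

/-! ### The generating function of self-conjugate partitions -/

open Maya

/-- The weight of a diagonal hook of length `2 * d + 1`. -/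
def diagonalWeight (q b : ℂ) (d : ℕ) : ℂ := q ^ (2 * d + 1) * b ^ ((-1 : ℤ) ^ d)

/-- The weight of the charge `c` of the runner `r`. -/
def chargeWeight (s : ℕ) (q b : ℂ) (r : ℕ) (c : ℤ) : ℂ :=
  q ^ coreSize s r c * b ^ ((-1 : ℤ) ^ r * c)

theorem prod_zpow_eq_zpow_sum {ι : Type*} {b : ℂ} (hb : b ≠ 0) (S : Finset ι) (f : ι → ℤ) :
    ∏ i ∈ S, b ^ f i = b ^ ∑ i ∈ S, f i := by
  classical
  induction S using Finset.induction_on with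
  | empty => simp
  | insert a S ha ih => rw [Finset.prod_insert ha, Finset.sum_insert ha, zpow_add₀ hb, ih]

theorem prod_diagonalWeight {b : ℂ} (hb : b ≠ 0) (q : ℂ) (D : Finset ℕ) :
    ∏ d ∈ D, diagonalWeight q b d = q ^ (∑ d ∈ D, (2 * d + 1)) * b ^ ∑ d ∈ D, (-1 : ℤ) ^ d := by
  unfold diagonalWeight
  rw [Finset.prod_mul_distrib, Finset.prod_pow_eq_pow_sum, prod_zpow_eq_zpow_sum hb]

theorem prod_diagonalWeight_runner {b : ℂ} (hb : b ≠ 0) (q : ℂ) {s r : ℕ} (hr : r < s)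
    (X : Finset ℤ) :
    ∏ k ∈ X, diagonalWeight q b (mag (2 * s * k + r)) =
      weight (chargeWeight s q b r) (q ^ (4 * s)) X := by
  unfold diagonalWeight weight chargeWeight
  rw [Finset.prod_mul_distrib, Finset.prod_pow_eq_pow_sum, prod_zpow_eq_zpow_sum hb,
    sum_size_runner hr, sum_sign_runner hr, pow_add, pow_mul]
  ring

theorem prod_diagonalWeight_eq_prod_weight {b : ℂ} (hb : b ≠ 0) (q : ℂ) {s : ℕ} (hs : 0 < s)
    (D : Finset ℕ) :
    ∏ d ∈ D, diagonalWeight q b d =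
      ∏ r : Fin s, weight (chargeWeight s q b r) (q ^ (4 * s)) (quotientEquiv hs D r) := by
  have h : ∏ d ∈ D, diagonalWeight q b d = ∏ r : Fin s, ∏ k ∈ quotientEquiv hs D r,
      diagonalWeight q b (mag (2 * s * k + (r : ℕ))) :=
    -- The additive reindexing, read in `Additive ℂ`, is the product formula.
    congrArg Multiplicative.toAdd.symm
      (sum_quotientEquiv hs D fun d => Additive.ofMul (diagonalWeight q b d))
  rw [h]
  exact Finset.prod_congr rfl fun r _ => prod_diagonalWeight_runner hb q r.2 _

/-! ### Infinite products and the charge series -/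

theorem summable_norm_diagonalWeight {q b : ℂ} (hq : ‖q‖ < 1) :
    Summable fun d => ‖diagonalWeight q b d‖ := by
  refine Summable.of_nonneg_of_le (fun d => norm_nonneg _) (fun d => ?_)
    ((summable_geometric_of_lt_one (norm_nonneg q) hq).mul_right (‖b‖ + ‖b⁻¹‖))
  rw [diagonalWeight, norm_mul, norm_pow]
  refine mul_le_mul (pow_le_pow_of_le_one (norm_nonneg q) hq.le (by omega)) ?_ (norm_nonneg _)
    (by positivity)
  rcases neg_one_pow_eq_or ℤ d with h | h <;> rw [h]
  · rw [zpow_one]; exact le_add_of_nonneg_right (norm_nonneg _)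
  · rw [zpow_neg_one]; exact le_add_of_nonneg_left (norm_nonneg _)

/-- Expand `∏ (1 + diagonalWeight q b d)`: even `d` give the factors of the first symbol, odd `d`
those of the second. -/
theorem qPochhammerInf_mul_eq_tsum {q b : ℂ} (hq : ‖q‖ < 1) :
    qPochhammerInf (-b * q) (q ^ 4) * qPochhammerInf (-q ^ 3 / b) (q ^ 4) =
      ∑' D : Finset ℕ, ∏ d ∈ D, diagonalWeight q b d := by
  have hq4 : ‖q ^ 4‖ < 1 := by
    rw [norm_pow]; exact pow_lt_one₀ (norm_nonneg q) hq (by norm_num)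
  rw [← tprod_one_add (summable_finsetProd_of_summable_norm (summable_norm_diagonalWeight hq))]
  have h : HasProd (fun d => 1 + diagonalWeight q b d)
      (qPochhammerInf (-b * q) (q ^ 4) * qPochhammerInf (-q ^ 3 / b) (q ^ 4)) := by
    refine HasProd.even_mul_odd ?_ ?_
    · refine (funext fun j => ?_ : _ = fun j : ℕ => 1 + diagonalWeight q b (2 * j)) ▸
        hasProd_qPochhammerInf (-b * q) hq4
      rw [diagonalWeight, pow_mul (-1 : ℤ)]
      simp only [even_two, Even.neg_pow, one_pow, zpow_one]
      ring
    · refine (funext fun j => ?_ : _ = fun j : ℕ => 1 + diagonalWeight q b (2 * j + 1)) ▸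
        hasProd_qPochhammerInf (-q ^ 3 / b) hq4
      rw [diagonalWeight, pow_succ (-1 : ℤ), pow_mul (-1 : ℤ)]
      simp only [even_two, Even.neg_pow, one_pow, one_mul, zpow_neg_one]
      ring
  exact h.tprod_eq.symm

/-- The shifted empty diagram of charge `c` has no inversions, so `chargeWeight` at `c` is one of
the finite products of diagonal weights on this runner, and those are absolutely summable. -/
theorem summable_norm_chargeWeight {q b : ℂ} (hq : ‖q‖ < 1) (hb : b ≠ 0) {s r : ℕ} (hr : r < s) :
    Summable fun c => ‖chargeWeight s q b r c‖ := by
  have hs : 0 < s := by omega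
  have h1 : Summable fun k : ℤ => ‖diagonalWeight q b (mag (2 * s * k + r))‖ :=
    (summable_norm_diagonalWeight hq).comp_injective (i := fun k : ℤ => mag (2 * s * k + r))
      fun k l h => by
        simpa using runnerEquiv_injOn hs ⟨r, hr⟩ Set.univ (Set.mem_univ k) (Set.mem_univ l) h
  have h2 := summable_finsetProd_of_summable_nonneg (fun k => norm_nonneg _) h1
  have hinv : inv ∅ = 0 := by
    have := wsum_energy ∅
    simp [wsum, charge] at this
    omega
  have hc : ∀ c : ℤ, charge (shift c ∅) = c := fun c => by
    rw [charge_shift, charge, wsum, Finset.sum_empty, zero_add]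
  refine (h2.comp_injective (i := fun c : ℤ => shift c ∅) fun c d h => ?_).congr fun c => ?_
  · rw [← hc c, ← hc d]; exact congrArg charge h
  · rw [Function.comp, ← norm_prod, prod_diagonalWeight_runner hb q hr, weight, hc, inv_shift, hinv,
      pow_zero, mul_one]

/-- The charge series do not involve `y`. Evaluating at `y = q ^ (4 * s)`, where all finite sets `D`
are being summed, eliminates them. -/
theorem prod_tsum_weight {q b y : ℂ} (hq : ‖q‖ < 1) (hb : b ≠ 0) (hy : ‖y‖ < 1) {s : ℕ}
    (hs : 0 < s) :
    ∏ r : Fin s, ∑' X, weight (chargeWeight s q b r) y X =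
      qPochhammerInf (q ^ (4 * s)) (q ^ (4 * s)) ^ s / qPochhammerInf y y ^ s *
        qPochhammerInf (-b * q) (q ^ 4) * qPochhammerInf (-q ^ 3 / b) (q ^ 4) := by
  have hq4 : ‖q ^ (4 * s)‖ < 1 := by
    rw [norm_pow]; exact pow_lt_one₀ (norm_nonneg q) hq (by omega)
  have hprod : ∀ {y : ℂ}, ‖y‖ < 1 → ∏ r : Fin s, ∑' X, weight (chargeWeight s q b r) y X =
      (∏ r : Fin s, ∑' c, chargeWeight s q b r c) * zeroChargeSum y ^ s := fun {y} hy => by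
    simp_rw [fun r : Fin s => tsum_weight (summable_norm_chargeWeight hq hb r.2) hy]
    rw [Finset.prod_mul_distrib]
    simp
  have h1 : qPochhammerInf (-b * q) (q ^ 4) * qPochhammerInf (-q ^ 3 / b) (q ^ 4) =
      (∏ r : Fin s, ∑' c, chargeWeight s q b r c) * zeroChargeSum (q ^ (4 * s)) ^ s := by
    rw [qPochhammerInf_mul_eq_tsum hq, ← hprod hq4,
      ← (hasSum_pi_prod _ fun r : Fin s =>
        summable_norm_weight (summable_norm_chargeWeight hq hb r.2) hq4).tsum_eq,
      ← (quotientEquiv hs).tsum_eq]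
    exact tsum_congr fun D => prod_diagonalWeight_eq_prod_weight hb q hs D
  have h2 := zeroChargeSum_mul hq4
  have h3 := zeroChargeSum_mul hy
  have h4 := right_ne_zero_of_mul_eq_one h3
  rw [hprod hy, mul_assoc, h1, eq_one_div_of_mul_eq_one_left h3]
  have h5 : qPochhammerInf (q ^ (4 * s)) (q ^ (4 * s)) ^ s * zeroChargeSum (q ^ (4 * s)) ^ s = 1 := by
    rw [← mul_pow, mul_comm, h2, one_pow]
  rw [div_pow, one_pow]
  field_simp
  linear_combination (-∏ r : Fin s, ∑' c, chargeWeight s q b r c) * h5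

/-! ### Polynomial bounds, the Lambert series and the final assembly -/

theorem norm_cpow_le {t : ℕ} (ht : 0 < t) (β : ℂ) {h : ℕ} (hh : 0 < h) :
    ‖((t * h : ℕ) : ℂ) ^ β‖ ≤ (t : ℝ) ^ ⌈β.re⌉₊ * (h : ℝ) ^ ⌈β.re⌉₊ := by
  have hp : 0 < t * h := Nat.mul_pos ht hh
  rw [Complex.norm_natCast_cpow_of_pos hp, ← mul_pow, ← Nat.cast_mul, ← Real.rpow_natCast]
  exact Real.rpow_le_rpow_of_exponent_le (by exact_mod_cast hp) (Nat.le_ceil _)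

theorem summable_lambert {y : ℂ} (hy : ‖y‖ < 1) {g : ℕ → ℂ} {C : ℝ} {N : ℕ}
    (hg : ∀ h, 0 < h → ‖g h‖ ≤ C * h ^ N) :
    Summable fun k : ℕ+ => g k * (y ^ (k : ℕ) / (1 - y ^ (k : ℕ))) := by
  have hC : 0 ≤ C := by simpa using (norm_nonneg _).trans (hg 1 one_pos)
  have hs : Summable fun n : ℕ => (n : ℝ) ^ N * ‖y‖ ^ n :=
    summable_pow_mul_geometric_of_norm_lt_one N (by simpa using hy)
  refine Summable.of_norm_bounded ((hs.comp_injective PNat.coe_injective).mul_left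
    (C * (1 - ‖y‖)⁻¹)) fun k => ?_
  have h1 : 1 - ‖y‖ ≤ ‖1 - y ^ (k : ℕ)‖ := by
    have h2 := norm_sub_norm_le (1 : ℂ) (y ^ (k : ℕ))
    rw [norm_one, norm_pow] at h2
    have h3 := pow_le_of_le_one (norm_nonneg y) hy.le k.ne_zero
    linarith
  have h0 : 0 < 1 - ‖y‖ := by linarith
  rw [norm_mul, norm_div, norm_pow, div_eq_mul_inv, Function.comp]
  calc ‖g k‖ * (‖y‖ ^ (k : ℕ) * ‖1 - y ^ (k : ℕ)‖⁻¹)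
      ≤ (C * (k : ℝ) ^ N) * (‖y‖ ^ (k : ℕ) * (1 - ‖y‖)⁻¹) := by
        gcongr
        exact hg _ k.pos
    _ = _ := by ring

/-- The summand of a self-conjugate partition in terms of its quotient. -/
theorem selfConjugate_term_eq {s : ℕ} (hs : 0 < s) (β q x : ℂ) {b : ℂ} (hb : b ≠ 0)
    (μ : YoungDiagram.selfConjugate) :
    q ^ (μ : YoungDiagram).card * x ^ (Multiset.card ((μ : YoungDiagram).hooksMod (2 * s))) *
        b ^ (μ : YoungDiagram).bgRank *
        (((μ : YoungDiagram).hooksMod (2 * s)).map fun h : ℕ => (h : ℂ) ^ β).sum =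
      (∏ r : Fin s, weight (chargeWeight s q b r) (x ^ 2 * q ^ (4 * s))
        (quotientEquiv hs (YoungDiagram.selfConjugateEquiv μ) r)) *
      ∑ r : Fin s, 2 * hookSum (fun h => ((2 * s * h : ℕ) : ℂ) ^ β)
        (quotientEquiv hs (YoungDiagram.selfConjugateEquiv μ) r) := by
  obtain ⟨μ, hμ⟩ := μ
  change μ.transpose = μ at hμ
  change _ = (∏ r : Fin s, weight _ _ (quotientEquiv hs μ.diagonalArms r)) *
    ∑ r : Fin s, 2 * hookSum _ (quotientEquiv hs μ.diagonalArms r)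
  -- Even multiplicity turns the power of `x` into `(x ^ 2) ^ inv` on each runner, which is absorbed
  -- into `y`.
  have h1 : Multiset.card (μ.hooksMod (2 * s)) =
      2 * ∑ r, inv (quotientEquiv hs μ.diagonalArms r) := by
    have := (YoungDiagram.sum_map_hooksMod hμ (2 * s) fun _ => (1 : ℕ)).trans
      (sum_pairs_double hs μ.diagonalArms fun _ => 1)
    simpa [inv] using this
  have h2 := (YoungDiagram.sum_map_hooksMod hμ (2 * s) fun h => (h : ℂ) ^ β).trans
    (sum_pairs_double hs μ.diagonalArms fun h => (h : ℂ) ^ β)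
  have h3 : q ^ μ.card * b ^ μ.bgRank = ∏ r : Fin s,
      weight (chargeWeight s q b r) (q ^ (4 * s)) (quotientEquiv hs μ.diagonalArms r) := by
    rw [YoungDiagram.card_selfConjugate hμ, YoungDiagram.bgRank_selfConjugate hμ,
      ← prod_diagonalWeight hb, prod_diagonalWeight_eq_prod_weight hb q hs]
  have h4 : ∀ r : Fin s, weight (chargeWeight s q b r) (x ^ 2 * q ^ (4 * s))
      (quotientEquiv hs μ.diagonalArms r) =
      weight (chargeWeight s q b r) (q ^ (4 * s)) (quotientEquiv hs μ.diagonalArms r) *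
        (x ^ 2) ^ inv (quotientEquiv hs μ.diagonalArms r) := fun r => by
    unfold weight; rw [mul_pow]; ring
  simp_rw [h4]
  rw [Finset.prod_mul_distrib, ← h3, Finset.prod_pow_eq_pow_sum, ← pow_mul, ← h1, h2,
    ← Finset.mul_sum, nsmul_eq_mul]
  unfold hookSum
  push_cast
  ring

end

open Maya in
theorem corollary4p4 (t : ℕ) (ht : 0 < t) (hte : Even t) (β q x b : ℂ)
    (hq : ‖q‖ < 1) (hx : ‖x ^ 2 * q ^ (2 * t)‖ < 1) (hb : b ≠ 0) :
    Summable (fun k : ℕ+ =>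
      ((t : ℂ) * (k : ℕ)) ^ (β + 1) *
        (x ^ (2 * (k : ℕ)) * q ^ (2 * (k : ℕ) * t) /
          (1 - x ^ (2 * (k : ℕ)) * q ^ (2 * (k : ℕ) * t)))) ∧
    HasSum (fun μ : YoungDiagram.selfConjugate =>
      q ^ (μ : YoungDiagram).card *
        x ^ (Multiset.card ((μ : YoungDiagram).hooksMod t)) *
        b ^ (μ : YoungDiagram).bgRank *
        (((μ : YoungDiagram).hooksMod t).map fun h : ℕ => (h : ℂ) ^ β).sum)
      (qPochhammerInf (q ^ (2 * t)) (q ^ (2 * t)) ^ (t / 2) /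
          qPochhammerInf (x ^ 2 * q ^ (2 * t)) (x ^ 2 * q ^ (2 * t)) ^ (t / 2) *
        qPochhammerInf (-b * q) (q ^ 4) *
        qPochhammerInf (-q ^ 3 / b) (q ^ 4) *
        ∑' k : ℕ+,
          ((t : ℂ) * (k : ℕ)) ^ (β + 1) *
            (x ^ (2 * (k : ℕ)) * q ^ (2 * (k : ℕ) * t) /
              (1 - x ^ (2 * (k : ℕ)) * q ^ (2 * (k : ℕ) * t)))) := by
  obtain ⟨s, rfl⟩ := hte.two_dvd
  have hs : 0 < s := by omega
  have h4s : 2 * (2 * s) = 4 * s := by ring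
  rw [h4s] at hx ⊢
  rw [Nat.mul_div_cancel_left s two_pos]
  set y := x ^ 2 * q ^ (4 * s) with hy
  have hyk : ∀ k : ℕ, x ^ (2 * k) * q ^ (2 * k * (2 * s)) = y ^ k := fun k => by
    rw [hy, mul_pow, ← pow_mul, ← pow_mul]; ring_nf
  simp_rw [hyk, ← Nat.cast_mul]
  refine ⟨summable_lambert hx (g := fun k => ((2 * s * k : ℕ) : ℂ) ^ (β + 1))
    fun h hh => norm_cpow_le ht (β + 1) hh, ?_⟩
  rw [← prod_tsum_weight hq hb hx hs]
  set g : ℕ → ℂ := fun h => ((2 * s * h : ℕ) : ℂ) ^ β with hgdef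
  have hg : ∀ h, 0 < h → ‖g h‖ ≤ ((2 * s : ℕ) : ℝ) ^ ⌈β.re⌉₊ * (h : ℝ) ^ ⌈β.re⌉₊ :=
    fun h hh => norm_cpow_le ht β hh
  have hθ := fun r : Fin s => summable_norm_chargeWeight hq hb r.2
  -- The `2` counts the mirror runners; with the `s` equal runner contributions it makes `2 * s =
  -- t`, and `t * k * (t * k) ^ β` is the required power.
  have key := hasSum_pi_prod_mul_sum (fun r : Fin s => weight (chargeWeight s q b r) y)
    (fun _ X => 2 * hookSum g X)
    (2 * ∑' k : ℕ+, k * g k * (y ^ (k : ℕ) / (1 - y ^ (k : ℕ))))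
    (fun r => summable_norm_weight (hθ r) hx)
    (fun r => ((summable_weight_hookSum (hθ r) hx hg).mul_left 2).congr fun X => by simp; ring)
    (fun r => by
      rw [mul_left_comm, ← (hasSum_weight_hookSum (hθ r) hx hg).tsum_eq, ← tsum_mul_left]
      exact tsum_congr fun X => by ring)
  rw [← (YoungDiagram.selfConjugateEquiv.trans (quotientEquiv hs)).hasSum_iff] at key
  refine key.of_eq (fun μ => selfConjugate_term_eq hs β q x hb μ) ?_
  congr 1
  rw [← tsum_mul_left, ← tsum_mul_left]
  refine tsum_congr fun k => ?_
  have hne : ((2 * s * (k : ℕ) : ℕ) : ℂ) ≠ 0 := by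
    exact_mod_cast (Nat.mul_pos ht k.pos).ne'
  rw [Complex.cpow_add _ _ hne, Complex.cpow_one, hgdef]
  push_cast
  ring
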